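/- Let $\mathbf{PInj}$ be the category whose objects are sets and whose morphisms are partial injections (partial functions that are injective where defined), with composition of relations; $f^\dagger$ is the inverse partial injection, and $f\le g$ means that $g$ extends $f$. Let $\mathbf{Hilb}$ be the category of complex Hilbert spaces and continuous linear maps; $f^\dagger$ is the adjoint, and $f\le g$ means that $\ker(f)^\perp\subseteq\ker(g)^\perp$ and $f(x)=g(x)$ for all $x\in\ker(f)^\perp$. For a set $X$ let $\ell^2(X)$ be the Hilbert space of functions $\varphi\colon X\to\mathbb{C}$ with $\sum_{x\in X}|\varphi(x)|^2<\infty$, and for a partial injection $f\colon X\to Y$ put \[(\ell^2 f)(\varphi)(y)=\sum_{x\in \mathrm{Dom}(f),\, f(x)=y}\varphi(x)\qquad(\varphi\in\ell^2(X),\ y\in Y).\] 1. (Well-defined functor) $\sum_{y\in Y}|(\ell^2 f)(\varphi)(y)|^2\le\sum_{x\in X}|\varphi(x)|^2<\infty$ for every $\varphi\in\ell^2(X)$, and $\ell^2$ is a functor $\mathbf{PInj}\to\mathbf{Hilb}$. 2. (Faithful) $\ell^2$ is faithful. 3. (Daggers) $\ell^2(f^\dagger)=(\ell^2 f)^\dagger$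 for every morphism $f$ of $\mathbf{PInj}$. 4. (Tensor products) $\ell^2$ is strong symmetric monoidal from $(\mathbf{PInj},\times,1)$, the Cartesian product of sets and of partial injections, to $(\mathbf{Hilb},\otimes,\mathbb{C})$, the Hilbert space tensor product; the structure maps $\mathbb{C}\cong\ell^2(1)$ and $\ell^2(X)\otimes\ell^2(Y)\cong\ell^2(X\times Y)$ are the canonical ones, sending $z$ to the function with value $z$, and $\varphi\otimes\psi$ to $(x,y)\mapsto\varphi(x)\psi(y)$. 5. (Direct sums) $\ell^2$ is strong symmetric monoidal from $(\mathbf{PInj},+,\emptyset)$, the disjoint union of sets and of partial injections, to $(\mathbf{Hilb},\oplus,0)$, the direct sum of Hilbert spaces; the structure map $\ell^2(X)\oplus\ell^2(Y)\cong\ell^2(X+Y)$ sends $(\varphi,\psi)$ to the cotuple $[\varphi,\psi]$. 6. (Directed suprema) For all sets $X,Y$ and every (nonempty) directed family $(f_i)$ of partial injections $X\to Y$, the supremum $\bigvee_i f_i$ exists in $\mathbf{PInj}(X,Y)$, the supremum $\bigvee_i \ell^2 f_i$ exists in $\mathbf{Hilb}(\ell^2(X),\ell^2(Y))$, and $\ell^2\bigl(\bigvee_i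 f_i\bigr)=\bigvee_i\ell^2 f_i$. 7. (Isomorphisms) If $\ell^2 f$ is an isomorphism of $\mathbf{Hilb}$, then $f$ is an isomorphism of $\mathbf{PInj}$. -/

import Mathlib

set_option linter.unusedSimpArgs false
open CategoryTheory MonoidalCategory
open scoped TensorProduct ENNReal
universe u

/-! ### Dagger categories -/

/-- A dagger on a category: a contravariant involution that is the identity on objects. -/
class DaggerCategory (C : Type*) [Category* C] where
  dag : ∀ {X Y : C}, (X ⟶ Y) → (Y ⟶ X)
  dag_id : ∀ X : C, dag (𝟙 X) = 𝟙 X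
  dag_comp : ∀ {X Y Z : C} (f : X ⟶ Y) (g : Y ⟶ Z), dag (f ≫ g) = dag g ≫ dag f
  dag_dag : ∀ {X Y : C} (f : X ⟶ Y), dag (dag f) = f

/-! ### Sets and partial injections -/

/-- Objects of the category of sets and partial injections: sets. -/
structure PInj where
  carrier : Type u

namespace PInj

/-- Morphisms are partial injections; `b ∈ f a` means that `f` is defined at `a` with value `b`. -/
@[ext]
structure Hom (X Y : PInj.{u}) where
  toPEquiv : X.carrier ≃. Y.carrier

instance : Category PInj.{u} where
  Hom X Y := Hom X Y
  id X := ⟨PEquiv.refl X.carrier⟩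
  comp f g := ⟨f.toPEquiv.trans g.toPEquiv⟩
  id_comp _ := Hom.ext (PEquiv.refl_trans _)
  comp_id _ := Hom.ext (PEquiv.trans_refl _)
  assoc _ _ _ := Hom.ext (PEquiv.trans_assoc _ _ _)

/-- The dagger is the inverse partial injection. -/
instance : DaggerCategory PInj.{u} where
  dag f := ⟨f.toPEquiv.symm⟩
  dag_id _ := rfl
  dag_comp _ _ := rfl
  dag_dag _ := rfl

/-- The extension order: `f ≤ g` when `g` is defined, with the same value, wherever `f` is. -/
instance (X Y : PInj.{u}) : PartialOrder (X ⟶ Y) :=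
  PartialOrder.lift (fun f : X ⟶ Y => f.toPEquiv) fun _ _ h => Hom.ext h

/-- A bijection, as an isomorphism. -/
def isoOfEquiv {X Y : PInj.{u}} (e : X.carrier ≃ Y.carrier) : X ≅ Y where
  hom := ⟨e.toPEquiv⟩
  inv := ⟨e.symm.toPEquiv⟩
  hom_inv_id := Hom.ext (by
    change e.toPEquiv.trans e.symm.toPEquiv = PEquiv.refl _
    rw [← Equiv.toPEquiv_trans]; simp)
  inv_hom_id := Hom.ext (by
    change e.symm.toPEquiv.trans e.toPEquiv = PEquiv.refl _
    rw [← Equiv.toPEquiv_trans]; simp)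

/-- The product of two partial injections, defined at `(a, b)` when both are defined. -/
def prodMap {A B C D : Type u} (f : A ≃. B) (g : C ≃. D) : A × C ≃. B × D where
  toFun p := (f p.1).bind fun b => (g p.2).map fun d => (b, d)
  invFun q := (f.symm q.1).bind fun a => (g.symm q.2).map fun c => (a, c)
  inv := by
    rintro ⟨a, c⟩ ⟨b, d⟩
    simp [Option.bind_eq_some_iff, PEquiv.eq_some_iff]

/-- The disjoint union of two partial injections. -/
def sumMap {A B C D : Type u} (f : A ≃. B) (g : C ≃. D) : A ⊕ C ≃. B ⊕ D where
  toFun := Sum.elim (fun a => (f a).map Sum.inl) (fun c => (g c).map Sum.inr)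
  invFun := Sum.elim (fun b => (f.symm b).map Sum.inl) (fun d => (g.symm d).map Sum.inr)
  inv := by
    rintro (a | c) (b | d) <;> simp [PEquiv.eq_some_iff]

theorem trans_apply {A B C : Type u} (f : A ≃. B) (g : B ≃. C) (a : A) :
    f.trans g a = (f a).bind g := rfl

theorem mem_prodMap {A B C D : Type u} (f : A ≃. B) (g : C ≃. D) (p : A × C) (q : B × D) :
    q ∈ prodMap f g p ↔ q.1 ∈ f p.1 ∧ q.2 ∈ g p.2 := by
  obtain ⟨a, c⟩ := p
  obtain ⟨b, d⟩ := q
  change (f a).bind (fun b => (g c).map fun d => (b, d)) = some (b, d) ↔ f a = some b ∧ g c = some d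
  simp [Option.bind_eq_some_iff]

@[simp] theorem sumMap_inl {A B C D : Type u} (f : A ≃. B) (g : C ≃. D) (a : A) :
    sumMap f g (Sum.inl a) = (f a).map Sum.inl := rfl

@[simp] theorem sumMap_inr {A B C D : Type u} (f : A ≃. B) (g : C ≃. D) (c : C) :
    sumMap f g (Sum.inr c) = (g c).map Sum.inr := rfl

theorem pequiv_ext_mem {A B : Type u} {f g : A ≃. B} (h : ∀ a b, b ∈ f a ↔ b ∈ g a) : f = g :=
  PEquiv.ext fun a => Option.ext fun b => h a b

theorem mem_refl {A : Type u} (a b : A) : b ∈ PEquiv.refl A a ↔ a = b := by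
  simp

theorem mem_toPEquiv {A B : Type u} (e : A ≃ B) (a : A) (b : B) : b ∈ e.toPEquiv a ↔ e a = b := by
  simp

/-- The monoidal structure on sets and partial injections given by the Cartesian product, with
unit a singleton. -/
@[reducible] def tensorMonoidal : MonoidalCategory PInj.{u} :=
  letI : MonoidalCategoryStruct PInj.{u} :=
    { tensorObj := fun X Y => ⟨X.carrier × Y.carrier⟩
      tensorHom := fun f g => ⟨prodMap f.toPEquiv g.toPEquiv⟩
      whiskerLeft := fun X _ _ g => ⟨prodMap (PEquiv.refl X.carrier) g.toPEquiv⟩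
      whiskerRight := fun f Y => ⟨prodMap f.toPEquiv (PEquiv.refl Y.carrier)⟩
      tensorUnit := ⟨PUnit⟩
      associator := fun X Y Z => isoOfEquiv (Equiv.prodAssoc X.carrier Y.carrier Z.carrier)
      leftUnitor := fun X => isoOfEquiv (Equiv.punitProd X.carrier)
      rightUnitor := fun X => isoOfEquiv (Equiv.prodPUnit X.carrier) }
  MonoidalCategory.ofTensorHom
    (id_tensorHom_id := fun X Y => Hom.ext <| by
      change prodMap (PEquiv.refl X.carrier) (PEquiv.refl Y.carrier) = PEquiv.refl _
      refine pequiv_ext_mem fun a b => ?_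
      simp only [mem_prodMap, mem_refl, Prod.ext_iff])
    (id_tensorHom := fun _ _ _ _ => rfl)
    (tensorHom_id := fun _ _ => rfl)
    (tensorHom_comp_tensorHom := fun f g h k => Hom.ext <| by
      change (prodMap f.toPEquiv g.toPEquiv).trans (prodMap h.toPEquiv k.toPEquiv) =
        prodMap (f.toPEquiv.trans h.toPEquiv) (g.toPEquiv.trans k.toPEquiv)
      refine pequiv_ext_mem fun a b => ?_
      simp only [PEquiv.mem_trans, mem_prodMap, Prod.exists]
      grind)
    (associator_naturality := fun {X₁ X₂ X₃ Y₁ Y₂ Y₃} f g h => Hom.ext <| by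
      change (prodMap (prodMap f.toPEquiv g.toPEquiv) h.toPEquiv).trans
          (Equiv.prodAssoc _ _ _).toPEquiv =
        (Equiv.prodAssoc X₁.carrier X₂.carrier X₃.carrier).toPEquiv.trans
          (prodMap f.toPEquiv (prodMap g.toPEquiv h.toPEquiv))
      refine pequiv_ext_mem ?_
      rintro ⟨⟨a, b⟩, c⟩ ⟨d, e, f⟩
      simp [PEquiv.mem_trans, mem_prodMap, mem_toPEquiv, and_assoc, -Option.mem_def,
        -Equiv.toPEquiv_apply])
    (leftUnitor_naturality := fun {X Y} f => Hom.ext <| by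
      change (prodMap (PEquiv.refl PUnit) f.toPEquiv).trans (Equiv.punitProd Y.carrier).toPEquiv =
        (Equiv.punitProd X.carrier).toPEquiv.trans f.toPEquiv
      refine pequiv_ext_mem ?_
      rintro ⟨⟨⟩, a⟩ b
      simp [PEquiv.mem_trans, mem_prodMap, mem_toPEquiv, mem_refl, -Option.mem_def,
        -Equiv.toPEquiv_apply, -PEquiv.refl_apply, and_assoc])
    (rightUnitor_naturality := fun {X Y} f => Hom.ext <| by
      change (prodMap f.toPEquiv (PEquiv.refl PUnit)).trans (Equiv.prodPUnit Y.carrier).toPEquiv =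
        (Equiv.prodPUnit X.carrier).toPEquiv.trans f.toPEquiv
      refine pequiv_ext_mem ?_
      rintro ⟨a, ⟨⟩⟩ b
      simp [PEquiv.mem_trans, mem_prodMap, mem_toPEquiv, mem_refl, -Option.mem_def,
        -Equiv.toPEquiv_apply, -PEquiv.refl_apply, and_assoc])
    (pentagon := fun W X Y Z => Hom.ext <| by
      change (prodMap (Equiv.prodAssoc W.carrier X.carrier Y.carrier).toPEquiv
          (PEquiv.refl Z.carrier)).trans ((Equiv.prodAssoc _ _ _).toPEquiv.trans
          (prodMap (PEquiv.refl _) (Equiv.prodAssoc _ _ _).toPEquiv)) =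
        (Equiv.prodAssoc _ _ _).toPEquiv.trans (Equiv.prodAssoc _ _ _).toPEquiv
      refine pequiv_ext_mem ?_
      rintro ⟨⟨⟨a, b⟩, c⟩, d⟩ ⟨a', b', c', d'⟩
      simp [PEquiv.mem_trans, mem_prodMap, mem_toPEquiv, mem_refl, -Option.mem_def,
        -Equiv.toPEquiv_apply, -PEquiv.refl_apply, and_assoc, and_comm, and_left_comm])
    (triangle := fun X Y => Hom.ext <| by
      change (Equiv.prodAssoc X.carrier PUnit Y.carrier).toPEquiv.trans
          (prodMap (PEquiv.refl _) (Equiv.punitProd _).toPEquiv) =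
        prodMap (Equiv.prodPUnit _).toPEquiv (PEquiv.refl _)
      refine pequiv_ext_mem ?_
      rintro ⟨⟨a, ⟨⟩⟩, c⟩ ⟨a', b'⟩
      simp [PEquiv.mem_trans, mem_prodMap, mem_toPEquiv, mem_refl, -Option.mem_def,
        -Equiv.toPEquiv_apply, -PEquiv.refl_apply, and_assoc, and_comm, and_left_comm])


/-- The symmetry `(x, y) ↦ (y, x)` for the Cartesian product. -/
@[reducible] def tensorSymmetric : @SymmetricCategory PInj.{u} _ tensorMonoidal :=
  letI := tensorMonoidal.{u}
  { braiding := fun X Y => isoOfEquiv (Equiv.prodComm X.carrier Y.carrier)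
    braiding_naturality_right := fun X {Y Z} f => Hom.ext <| by
      change (prodMap (PEquiv.refl X.carrier) f.toPEquiv).trans (Equiv.prodComm _ _).toPEquiv =
        (Equiv.prodComm X.carrier Y.carrier).toPEquiv.trans
          (prodMap f.toPEquiv (PEquiv.refl X.carrier))
      refine pequiv_ext_mem ?_
      rintro ⟨a, b⟩ ⟨c, d⟩
      simp [PEquiv.mem_trans, mem_prodMap, mem_toPEquiv, mem_refl, -Option.mem_def,
        -Equiv.toPEquiv_apply, -PEquiv.refl_apply, and_comm]
    braiding_naturality_left := fun {X Y} f Z => Hom.ext <| by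
      change (prodMap f.toPEquiv (PEquiv.refl Z.carrier)).trans (Equiv.prodComm _ _).toPEquiv =
        (Equiv.prodComm X.carrier Z.carrier).toPEquiv.trans
          (prodMap (PEquiv.refl Z.carrier) f.toPEquiv)
      refine pequiv_ext_mem ?_
      rintro ⟨a, b⟩ ⟨c, d⟩
      simp [PEquiv.mem_trans, mem_prodMap, mem_toPEquiv, mem_refl, -Option.mem_def,
        -Equiv.toPEquiv_apply, -PEquiv.refl_apply, and_comm]
    hexagon_forward := fun X Y Z => Hom.ext <| by
      change (Equiv.prodAssoc X.carrier Y.carrier Z.carrier).toPEquiv.trans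
          ((Equiv.prodComm _ _).toPEquiv.trans (Equiv.prodAssoc _ _ _).toPEquiv) =
        (prodMap (Equiv.prodComm _ _).toPEquiv (PEquiv.refl _)).trans
          ((Equiv.prodAssoc _ _ _).toPEquiv.trans
            (prodMap (PEquiv.refl _) (Equiv.prodComm _ _).toPEquiv))
      refine pequiv_ext_mem ?_
      rintro ⟨⟨a, b⟩, c⟩ ⟨d, e, f⟩
      simp [PEquiv.mem_trans, mem_prodMap, mem_toPEquiv, mem_refl, -Option.mem_def,
        -Equiv.toPEquiv_apply, -PEquiv.refl_apply, and_assoc, and_comm, and_left_comm]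
    hexagon_reverse := fun X Y Z => Hom.ext <| by
      change (Equiv.prodAssoc X.carrier Y.carrier Z.carrier).symm.toPEquiv.trans
          ((Equiv.prodComm _ _).toPEquiv.trans (Equiv.prodAssoc _ _ _).symm.toPEquiv) =
        (prodMap (PEquiv.refl _) (Equiv.prodComm _ _).toPEquiv).trans
          ((Equiv.prodAssoc _ _ _).symm.toPEquiv.trans
            (prodMap (Equiv.prodComm _ _).toPEquiv (PEquiv.refl _)))
      refine pequiv_ext_mem ?_
      rintro ⟨a, b, c⟩ ⟨⟨d, e⟩, f⟩
      simp [PEquiv.mem_trans, mem_prodMap, mem_toPEquiv, mem_refl, -Option.mem_def,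
        -Equiv.toPEquiv_apply, -PEquiv.refl_apply, and_assoc, and_comm, and_left_comm]
    symmetry := fun X Y => (isoOfEquiv (Equiv.prodComm X.carrier Y.carrier)).hom_inv_id }

/-- The monoidal structure on sets and partial injections given by disjoint union, with unit the
empty set. -/
@[reducible] def sumMonoidal : MonoidalCategory PInj.{u} :=
  letI : MonoidalCategoryStruct PInj.{u} :=
    { tensorObj := fun X Y => ⟨X.carrier ⊕ Y.carrier⟩
      tensorHom := fun f g => ⟨sumMap f.toPEquiv g.toPEquiv⟩
      whiskerLeft := fun X _ _ g => ⟨sumMap (PEquiv.refl X.carrier) g.toPEquiv⟩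
      whiskerRight := fun f Y => ⟨sumMap f.toPEquiv (PEquiv.refl Y.carrier)⟩
      tensorUnit := ⟨PEmpty⟩
      associator := fun X Y Z => isoOfEquiv (Equiv.sumAssoc X.carrier Y.carrier Z.carrier)
      leftUnitor := fun X => isoOfEquiv (Equiv.emptySum PEmpty X.carrier)
      rightUnitor := fun X => isoOfEquiv (Equiv.sumEmpty X.carrier PEmpty) }
  MonoidalCategory.ofTensorHom
    (id_tensorHom_id := fun X Y => Hom.ext <| by
      change sumMap (PEquiv.refl X.carrier) (PEquiv.refl Y.carrier) = PEquiv.refl _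
      refine PEquiv.ext ?_
      rintro (a | b) <;> simp)
    (id_tensorHom := fun _ _ _ _ => rfl)
    (tensorHom_id := fun _ _ => rfl)
    (tensorHom_comp_tensorHom := fun f g h k => Hom.ext <| by
      change (sumMap f.toPEquiv g.toPEquiv).trans (sumMap h.toPEquiv k.toPEquiv) =
        sumMap (f.toPEquiv.trans h.toPEquiv) (g.toPEquiv.trans k.toPEquiv)
      refine PEquiv.ext ?_
      rintro (a | b) <;>
        simp [trans_apply, Option.bind_map, Option.map_bind, Function.comp_def])
    (associator_naturality := fun {X₁ X₂ X₃ Y₁ Y₂ Y₃} f g h => Hom.ext <| by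
      change (sumMap (sumMap f.toPEquiv g.toPEquiv) h.toPEquiv).trans
          (Equiv.sumAssoc _ _ _).toPEquiv =
        (Equiv.sumAssoc X₁.carrier X₂.carrier X₃.carrier).toPEquiv.trans
          (sumMap f.toPEquiv (sumMap g.toPEquiv h.toPEquiv))
      refine PEquiv.ext ?_
      rintro ((a | b) | c)
      · cases hx : f.toPEquiv a <;> simp [trans_apply, hx]
      · cases hx : g.toPEquiv b <;> simp [trans_apply, hx]
      · cases hx : h.toPEquiv c <;> simp [trans_apply, hx])
    (leftUnitor_naturality := fun {X Y} f => Hom.ext <| by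
      change (sumMap (PEquiv.refl PEmpty) f.toPEquiv).trans
          (Equiv.emptySum PEmpty Y.carrier).toPEquiv =
        (Equiv.emptySum PEmpty X.carrier).toPEquiv.trans f.toPEquiv
      refine PEquiv.ext ?_
      rintro (⟨⟨⟩⟩ | b)
      simp [trans_apply, Option.bind_map, Function.comp_def])
    (rightUnitor_naturality := fun {X Y} f => Hom.ext <| by
      change (sumMap f.toPEquiv (PEquiv.refl PEmpty)).trans
          (Equiv.sumEmpty Y.carrier PEmpty).toPEquiv =
        (Equiv.sumEmpty X.carrier PEmpty).toPEquiv.trans f.toPEquiv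
      refine PEquiv.ext ?_
      rintro (b | ⟨⟨⟩⟩)
      simp [trans_apply, Option.bind_map, Function.comp_def])
    (pentagon := fun W X Y Z => Hom.ext <| by
      change (sumMap (Equiv.sumAssoc W.carrier X.carrier Y.carrier).toPEquiv
          (PEquiv.refl Z.carrier)).trans ((Equiv.sumAssoc _ _ _).toPEquiv.trans
          (sumMap (PEquiv.refl _) (Equiv.sumAssoc _ _ _).toPEquiv)) =
        (Equiv.sumAssoc _ _ _).toPEquiv.trans (Equiv.sumAssoc _ _ _).toPEquiv
      refine PEquiv.ext ?_
      rintro (((a | b) | c) | d) <;> simp [trans_apply])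
    (triangle := fun X Y => Hom.ext <| by
      change (Equiv.sumAssoc X.carrier PEmpty Y.carrier).toPEquiv.trans
          (sumMap (PEquiv.refl _) (Equiv.emptySum PEmpty _).toPEquiv) =
        sumMap (Equiv.sumEmpty _ PEmpty).toPEquiv (PEquiv.refl _)
      refine PEquiv.ext ?_
      rintro ((a | ⟨⟨⟩⟩) | c) <;> simp [trans_apply])

/-- The symmetry exchanging the two summands of a disjoint union. -/
@[reducible] def sumSymmetric : @SymmetricCategory PInj.{u} _ sumMonoidal :=
  letI := sumMonoidal.{u}
  { braiding := fun X Y => isoOfEquiv (Equiv.sumComm X.carrier Y.carrier)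
    braiding_naturality_right := fun X {Y Z} f => Hom.ext <| by
      change (sumMap (PEquiv.refl X.carrier) f.toPEquiv).trans (Equiv.sumComm _ _).toPEquiv =
        (Equiv.sumComm X.carrier Y.carrier).toPEquiv.trans
          (sumMap f.toPEquiv (PEquiv.refl X.carrier))
      refine PEquiv.ext ?_
      rintro (a | b)
      · simp [trans_apply]
      · cases hx : f.toPEquiv b <;> simp [trans_apply, hx]
    braiding_naturality_left := fun {X Y} f Z => Hom.ext <| by
      change (sumMap f.toPEquiv (PEquiv.refl Z.carrier)).trans (Equiv.sumComm _ _).toPEquiv =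
        (Equiv.sumComm X.carrier Z.carrier).toPEquiv.trans
          (sumMap (PEquiv.refl Z.carrier) f.toPEquiv)
      refine PEquiv.ext ?_
      rintro (a | b)
      · cases hx : f.toPEquiv a <;> simp [trans_apply, hx]
      · simp [trans_apply]
    hexagon_forward := fun X Y Z => Hom.ext <| by
      change (Equiv.sumAssoc X.carrier Y.carrier Z.carrier).toPEquiv.trans
          ((Equiv.sumComm _ _).toPEquiv.trans (Equiv.sumAssoc _ _ _).toPEquiv) =
        (sumMap (Equiv.sumComm _ _).toPEquiv (PEquiv.refl _)).trans
          ((Equiv.sumAssoc _ _ _).toPEquiv.trans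
            (sumMap (PEquiv.refl _) (Equiv.sumComm _ _).toPEquiv))
      refine PEquiv.ext ?_
      rintro ((a | b) | c) <;> simp [trans_apply]
    hexagon_reverse := fun X Y Z => Hom.ext <| by
      change (Equiv.sumAssoc X.carrier Y.carrier Z.carrier).symm.toPEquiv.trans
          ((Equiv.sumComm _ _).toPEquiv.trans (Equiv.sumAssoc _ _ _).symm.toPEquiv) =
        (sumMap (PEquiv.refl _) (Equiv.sumComm _ _).toPEquiv).trans
          ((Equiv.sumAssoc _ _ _).symm.toPEquiv.trans
            (sumMap (Equiv.sumComm _ _).toPEquiv (PEquiv.refl _)))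
      refine PEquiv.ext ?_
      rintro (a | b | c) <;> simp [trans_apply]
    symmetry := fun X Y => (isoOfEquiv (Equiv.sumComm X.carrier Y.carrier)).hom_inv_id }

end PInj

/-! ### The tensor product and the direct sum of Hilbert spaces -/

noncomputable section

instance ULift.instInnerComplex : InnerProductSpace ℂ (ULift.{u} ℂ) where
  inner x y := inner ℂ x.down y.down
  norm_sq_eq_re_inner x := norm_sq_eq_re_inner (𝕜 := ℂ) x.down
  conj_inner_symm x y := inner_conj_symm (𝕜 := ℂ) x.down y.down
  add_left x y z := inner_add_left (𝕜 := ℂ) x.down y.down z.down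
  smul_left x y r := inner_smul_left (𝕜 := ℂ) x.down y.down r

/-- The unit Hilbert space `ℂ`, placed in an arbitrary universe. -/
def uliftIsometry : ULift.{u} ℂ ≃ₗᵢ[ℂ] ℂ where
  toLinearEquiv := ULift.moduleEquiv
  norm_map' _ := rfl

@[simp] theorem uliftIsometry_apply (z : ULift.{u} ℂ) : uliftIsometry z = z.down := rfl

/-- The Hilbert tensor product: the completion of the algebraic tensor product for the inner
product with `⟪a ⊗ b, c ⊗ d⟫ = ⟪a, c⟫ * ⟪b, d⟫`. -/
abbrev HilbertTensor (E F : Type u) [NormedAddCommGroup E] [InnerProductSpace ℂ E]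
    [NormedAddCommGroup F] [InnerProductSpace ℂ F] : Type u :=
  UniformSpace.Completion (E ⊗[ℂ] F)

namespace HilbertTensor

variable {A B C D A' B' C' : Type u}
  [NormedAddCommGroup A] [InnerProductSpace ℂ A] [NormedAddCommGroup B] [InnerProductSpace ℂ B]
  [NormedAddCommGroup C] [InnerProductSpace ℂ C] [NormedAddCommGroup D] [InnerProductSpace ℂ D]
  [NormedAddCommGroup A'] [InnerProductSpace ℂ A'] [NormedAddCommGroup B'] [InnerProductSpace ℂ B']
  [NormedAddCommGroup C'] [InnerProductSpace ℂ C']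

/-- The canonical dense isometric embedding of the algebraic tensor product. -/
def incl (A B : Type u) [NormedAddCommGroup A] [InnerProductSpace ℂ A]
    [NormedAddCommGroup B] [InnerProductSpace ℂ B] : A ⊗[ℂ] B →ₗᵢ[ℂ] HilbertTensor A B :=
  UniformSpace.Completion.toComplₗᵢ

theorem denseRange_incl : DenseRange (incl A B) :=
  UniformSpace.Completion.denseRange_coe

/-- Pure tensors, as a continuous bilinear map. -/
def tmulL (A B : Type u) [NormedAddCommGroup A] [InnerProductSpace ℂ A]
    [NormedAddCommGroup B] [InnerProductSpace ℂ B] : A →L[ℂ] B →L[ℂ] HilbertTensor A B :=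
  (ContinuousLinearMap.compL ℂ B (A ⊗[ℂ] B) (HilbertTensor A B)
    (incl A B).toContinuousLinearMap).comp (TensorProduct.mkL ℂ A B)

/-- The pure tensor `a ⊗ b` in the Hilbert tensor product. -/
def tmul (a : A) (b : B) : HilbertTensor A B := incl A B (a ⊗ₜ[ℂ] b)

theorem tmulL_apply (a : A) (b : B) : tmulL A B a b = tmul a b := rfl

/-- Continuous linear maps out of a Hilbert tensor product agree if they do on pure tensors. -/
theorem ext_tmul {f g : HilbertTensor A B →L[ℂ] C} (h : ∀ a b, f (tmul a b) = g (tmul a b)) :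
    f = g := by
  have h1 : f.comp (incl A B).toContinuousLinearMap = g.comp (incl A B).toContinuousLinearMap := by
    ext x
    induction x with
    | zero => simp
    | tmul a b => exact h a b
    | add x y hx hy => simp only [map_add, hx, hy]
  ext x
  exact congrFun (denseRange_incl.equalizer f.continuous g.continuous
    (funext fun x => congrArg (fun k => k x) h1)) x

/-- The tensor product of two continuous linear maps. -/
def map (f : A →L[ℂ] A') (g : B →L[ℂ] B') : HilbertTensor A B →L[ℂ] HilbertTensor A' B' :=
  ((incl A' B').toContinuousLinearMap.comp (TensorProduct.mapL f g)).extend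
    (incl A B).toContinuousLinearMap

@[simp] theorem map_tmul (f : A →L[ℂ] A') (g : B →L[ℂ] B') (a : A) (b : B) :
    map f g (tmul a b) = tmul (f a) (g b) :=
  (ContinuousLinearMap.extend_eq ((incl A' B').toContinuousLinearMap.comp (TensorProduct.mapL f g))
    (e := (incl A B).toContinuousLinearMap) denseRange_incl
    (incl A B).isometry.isUniformInducing (a ⊗ₜ[ℂ] b)).trans <| by
      simp [tmul]

/-- The embedding of `(A ⊗ B) ⊗ C`. -/
def inclLeft (A B C : Type u) [NormedAddCommGroup A] [InnerProductSpace ℂ A]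
    [NormedAddCommGroup B] [InnerProductSpace ℂ B] [NormedAddCommGroup C] [InnerProductSpace ℂ C] :
    (A ⊗[ℂ] B) ⊗[ℂ] C →ₗᵢ[ℂ] HilbertTensor (HilbertTensor A B) C :=
  (incl (HilbertTensor A B) C).comp (TensorProduct.mapIsometry (incl A B) LinearIsometry.id)

/-- The embedding of `A ⊗ (B ⊗ C)`. -/
def inclRight (A B C : Type u) [NormedAddCommGroup A] [InnerProductSpace ℂ A]
    [NormedAddCommGroup B] [InnerProductSpace ℂ B] [NormedAddCommGroup C] [InnerProductSpace ℂ C] :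
    A ⊗[ℂ] (B ⊗[ℂ] C) →ₗᵢ[ℂ] HilbertTensor A (HilbertTensor B C) :=
  (incl A (HilbertTensor B C)).comp (TensorProduct.mapIsometry LinearIsometry.id (incl B C))

/-- A closed subspace containing all pure tensors is everything. -/
theorem eq_top_of_tmul_mem {S : Submodule ℂ (HilbertTensor A B)} (hS : IsClosed (S : Set (HilbertTensor A B)))
    (h : ∀ a b, tmul a b ∈ S) (x : HilbertTensor A B) : x ∈ S := by
  refine UniformSpace.Completion.induction_on x hS fun t => ?_
  change incl A B t ∈ S
  induction t with
  | zero => simp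
  | tmul a b => exact h a b
  | add x y hx hy => rw [map_add]; exact S.add_mem hx hy

theorem denseRange_inclLeft : DenseRange (inclLeft A B C) := by
  intro x
  have key := eq_top_of_tmul_mem
    (S := (LinearMap.range (inclLeft A B C).toLinearMap).topologicalClosure)
    (Submodule.isClosed_topologicalClosure _) (fun z c => ?_) x
  · exact key
  · refine UniformSpace.Completion.induction_on z ?_ fun t => ?_
    · exact (Submodule.isClosed_topologicalClosure _).preimage
        ((tmulL (HilbertTensor A B) C).flip c).continuous
    · exact Submodule.le_topologicalClosure _ ⟨t ⊗ₜ c, rfl⟩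

theorem denseRange_inclRight : DenseRange (inclRight A B C) := by
  intro x
  have key := eq_top_of_tmul_mem
    (S := (LinearMap.range (inclRight A B C).toLinearMap).topologicalClosure)
    (Submodule.isClosed_topologicalClosure _) (fun a z => ?_) x
  · exact key
  · refine UniformSpace.Completion.induction_on z ?_ fun t => ?_
    · exact (Submodule.isClosed_topologicalClosure _).preimage
        (tmulL A (HilbertTensor B C) a).continuous
    · exact Submodule.le_topologicalClosure _ ⟨a ⊗ₜ t, rfl⟩

/-- The extension of a unitary between dense subspaces to the whole Hilbert spaces. -/
def extendIso {H K : Type u} [NormedAddCommGroup H] [InnerProductSpace ℂ H] [CompleteSpace H]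
    [NormedAddCommGroup K] [InnerProductSpace ℂ K] [CompleteSpace K]
    (f : A ≃ₗᵢ[ℂ] B) (e₁ : A →ₗᵢ[ℂ] H) (e₂ : B →ₗᵢ[ℂ] K) (h₁ : DenseRange e₁)
    (h₂ : DenseRange e₂) : H ≃L[ℂ] K :=
  (f.toLinearEquiv.extendOfIsometry e₁.toLinearMap e₂.toLinearMap h₁ h₂
    fun x => by simp).toContinuousLinearEquiv

theorem extendIso_apply {H K : Type u} [NormedAddCommGroup H] [InnerProductSpace ℂ H]
    [CompleteSpace H] [NormedAddCommGroup K] [InnerProductSpace ℂ K] [CompleteSpace K]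
    (f : A ≃ₗᵢ[ℂ] B) (e₁ : A →ₗᵢ[ℂ] H) (e₂ : B →ₗᵢ[ℂ] K) (h₁ : DenseRange e₁)
    (h₂ : DenseRange e₂) (x : A) : extendIso f e₁ e₂ h₁ h₂ (e₁ x) = e₂ (f x) :=
  LinearEquiv.extendOfIsometry_eq f.toLinearEquiv e₁.toLinearMap e₂.toLinearMap h₁ h₂
    (fun x => by simp) x

/-- The associativity unitary `(a ⊗ b) ⊗ c ↦ a ⊗ (b ⊗ c)`. -/
def assoc (A B C : Type u) [NormedAddCommGroup A] [InnerProductSpace ℂ A]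
    [NormedAddCommGroup B] [InnerProductSpace ℂ B] [NormedAddCommGroup C] [InnerProductSpace ℂ C] :
    HilbertTensor (HilbertTensor A B) C ≃L[ℂ] HilbertTensor A (HilbertTensor B C) :=
  extendIso (TensorProduct.assocIsometry ℂ A B C) (inclLeft A B C) (inclRight A B C)
    denseRange_inclLeft denseRange_inclRight

theorem inclLeft_tmul (a : A) (b : B) (c : C) :
    inclLeft A B C ((a ⊗ₜ[ℂ] b) ⊗ₜ[ℂ] c) = tmul (tmul a b) c := by
  simp [inclLeft, tmul]

theorem inclRight_tmul (a : A) (b : B) (c : C) :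
    inclRight A B C (a ⊗ₜ[ℂ] (b ⊗ₜ[ℂ] c)) = tmul a (tmul b c) := by
  simp [inclRight, tmul]

@[simp] theorem assoc_tmul (a : A) (b : B) (c : C) :
    assoc A B C (tmul (tmul a b) c) = tmul a (tmul b c) := by
  rw [← inclLeft_tmul, ← inclRight_tmul]
  rw [assoc, extendIso_apply, TensorProduct.assocIsometry_apply, TensorProduct.assoc_tmul]

@[simp] theorem assoc_symm_tmul (a : A) (b : B) (c : C) :
    (assoc A B C).symm (tmul a (tmul b c)) = tmul (tmul a b) c := by
  rw [← assoc_tmul, ContinuousLinearEquiv.symm_apply_apply]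

/-- The symmetry `a ⊗ b ↦ b ⊗ a`. -/
def comm (A B : Type u) [NormedAddCommGroup A] [InnerProductSpace ℂ A]
    [NormedAddCommGroup B] [InnerProductSpace ℂ B] : HilbertTensor A B ≃L[ℂ] HilbertTensor B A :=
  extendIso (TensorProduct.commIsometry ℂ A B) (incl A B) (incl B A)
    denseRange_incl denseRange_incl

@[simp] theorem comm_tmul (a : A) (b : B) : comm A B (tmul a b) = tmul b a :=
  extendIso_apply _ _ _ denseRange_incl denseRange_incl (a ⊗ₜ b)

@[simp] theorem comm_symm_tmul (a : A) (b : B) : (comm A B).symm (tmul b a) = tmul a b := by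
  rw [← comm_tmul, ContinuousLinearEquiv.symm_apply_apply]

/-- The left unit unitary `z ⊗ a ↦ z • a`. -/
def lunit (A : Type u) [NormedAddCommGroup A] [InnerProductSpace ℂ A] [CompleteSpace A] :
    HilbertTensor (ULift.{u} ℂ) A ≃L[ℂ] A :=
  extendIso ((TensorProduct.congrIsometry uliftIsometry (LinearIsometryEquiv.refl ℂ A)).trans
    (TensorProduct.lidIsometry ℂ A)) (incl (ULift.{u} ℂ) A) LinearIsometry.id denseRange_incl
    Function.surjective_id.denseRange

@[simp] theorem lunit_tmul [CompleteSpace A] (z : ULift.{u} ℂ) (a : A) :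
    lunit A (tmul z a) = z.down • a :=
  extendIso_apply _ _ _ denseRange_incl Function.surjective_id.denseRange (z ⊗ₜ a)

/-- The right unit unitary `a ⊗ z ↦ z • a`. -/
def runit (A : Type u) [NormedAddCommGroup A] [InnerProductSpace ℂ A] [CompleteSpace A] :
    HilbertTensor A (ULift.{u} ℂ) ≃L[ℂ] A :=
  (comm A (ULift.{u} ℂ)).trans (lunit A)

@[simp] theorem runit_tmul [CompleteSpace A] (z : ULift.{u} ℂ) (a : A) :
    runit A (tmul a z) = z.down • a := by
  simp [runit]

theorem tmul_smul (a : A) (z : ℂ) (b : B) : tmul a (z • b) = tmul (z • a) b := by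
  simp [tmul, TensorProduct.tmul_smul, TensorProduct.smul_tmul]

end HilbertTensor

/-- The direct sum of two Hilbert spaces: pairs with `‖(a, b)‖ ^ 2 = ‖a‖ ^ 2 + ‖b‖ ^ 2`. -/
abbrev HilbertSum (E F : Type u) : Type u := WithLp 2 (E × F)

namespace HilbertSum

variable {A B C D A' B' C' : Type u}
  [NormedAddCommGroup A] [InnerProductSpace ℂ A] [NormedAddCommGroup B] [InnerProductSpace ℂ B]
  [NormedAddCommGroup C] [InnerProductSpace ℂ C] [NormedAddCommGroup D] [InnerProductSpace ℂ D]
  [NormedAddCommGroup A'] [InnerProductSpace ℂ A'] [NormedAddCommGroup B'] [InnerProductSpace ℂ B']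

/-- The underlying pair, as an isomorphism of topological vector spaces. -/
def toPair (A B : Type u) [NormedAddCommGroup A] [InnerProductSpace ℂ A]
    [NormedAddCommGroup B] [InnerProductSpace ℂ B] : HilbertSum A B ≃L[ℂ] A × B :=
  WithLp.prodContinuousLinearEquiv 2 ℂ A B

@[simp] theorem toPair_apply (x : HilbertSum A B) : toPair A B x = (x.fst, x.snd) := rfl
@[simp] theorem toPair_symm_fst (x : A × B) : ((toPair A B).symm x).fst = x.1 := rfl
@[simp] theorem toPair_symm_snd (x : A × B) : ((toPair A B).symm x).snd = x.2 := rfl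

theorem ext_fst_snd {x y : HilbertSum A B} (h1 : x.fst = y.fst) (h2 : x.snd = y.snd) : x = y :=
  (toPair A B).injective (Prod.ext h1 h2)

/-- The direct sum of two continuous linear maps. -/
def map (f : A →L[ℂ] A') (g : B →L[ℂ] B') : HilbertSum A B →L[ℂ] HilbertSum A' B' :=
  ((toPair A' B').symm : A' × B' →L[ℂ] HilbertSum A' B').comp
    ((f.prodMap g).comp (toPair A B : HilbertSum A B →L[ℂ] A × B))

@[simp] theorem map_fst (f : A →L[ℂ] A') (g : B →L[ℂ] B') (x : HilbertSum A B) :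
    (map f g x).fst = f x.fst := rfl
@[simp] theorem map_snd (f : A →L[ℂ] A') (g : B →L[ℂ] B') (x : HilbertSum A B) :
    (map f g x).snd = g x.snd := rfl

/-- The associativity unitary of direct sums. -/
def assoc (A B C : Type u) [NormedAddCommGroup A] [InnerProductSpace ℂ A]
    [NormedAddCommGroup B] [InnerProductSpace ℂ B] [NormedAddCommGroup C] [InnerProductSpace ℂ C] :
    HilbertSum (HilbertSum A B) C ≃L[ℂ] HilbertSum A (HilbertSum B C) :=
  (toPair (HilbertSum A B) C).trans <|
    ((toPair A B).prodCongr (ContinuousLinearEquiv.refl ℂ C)).trans <|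
    (ContinuousLinearEquiv.prodAssoc ℂ A B C).trans <|
    ((ContinuousLinearEquiv.refl ℂ A).prodCongr (toPair B C).symm).trans
    (toPair A (HilbertSum B C)).symm

@[simp] theorem assoc_fst (x : HilbertSum (HilbertSum A B) C) :
    (assoc A B C x).fst = x.fst.fst := rfl
@[simp] theorem assoc_snd_fst (x : HilbertSum (HilbertSum A B) C) :
    (assoc A B C x).snd.fst = x.fst.snd := rfl
@[simp] theorem assoc_snd_snd (x : HilbertSum (HilbertSum A B) C) :
    (assoc A B C x).snd.snd = x.snd := rfl
@[simp] theorem assoc_symm_fst_fst (x : HilbertSum A (HilbertSum B C)) :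
    ((assoc A B C).symm x).fst.fst = x.fst := rfl
@[simp] theorem assoc_symm_fst_snd (x : HilbertSum A (HilbertSum B C)) :
    ((assoc A B C).symm x).fst.snd = x.snd.fst := rfl
@[simp] theorem assoc_symm_snd (x : HilbertSum A (HilbertSum B C)) :
    ((assoc A B C).symm x).snd = x.snd.snd := rfl

/-- The symmetry of direct sums. -/
def comm (A B : Type u) [NormedAddCommGroup A] [InnerProductSpace ℂ A]
    [NormedAddCommGroup B] [InnerProductSpace ℂ B] : HilbertSum A B ≃L[ℂ] HilbertSum B A :=
  (toPair A B).trans ((ContinuousLinearEquiv.prodComm ℂ A B).trans (toPair B A).symm)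

@[simp] theorem comm_fst (x : HilbertSum A B) : (comm A B x).fst = x.snd := rfl
@[simp] theorem comm_snd (x : HilbertSum A B) : (comm A B x).snd = x.fst := rfl

/-- The left unit unitary `(0, a) ↦ a`. -/
def lunit (A : Type u) [NormedAddCommGroup A] [InnerProductSpace ℂ A] :
    HilbertSum PUnit.{u + 1} A ≃L[ℂ] A :=
  (toPair PUnit A).trans (ContinuousLinearEquiv.uniqueProd ℂ A PUnit.{u + 1})

@[simp] theorem lunit_apply (x : HilbertSum PUnit.{u + 1} A) : lunit A x = x.snd := rfl

/-- The right unit unitary `(a, 0) ↦ a`. -/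
def runit (A : Type u) [NormedAddCommGroup A] [InnerProductSpace ℂ A] :
    HilbertSum A PUnit.{u + 1} ≃L[ℂ] A :=
  (toPair A PUnit).trans (ContinuousLinearEquiv.prodUnique ℂ A PUnit.{u + 1})

@[simp] theorem runit_apply (x : HilbertSum A PUnit.{u + 1}) : runit A x = x.fst := rfl

end HilbertSum
end

/-! ### Hilbert spaces and continuous linear maps -/

noncomputable section

/-- Objects of the category of Hilbert spaces: complex Hilbert spaces. -/
structure Hilb where
  of ::
  carrier : Type u
  [normedAddCommGroup : NormedAddCommGroup carrier]
  [innerProductSpace : InnerProductSpace ℂ carrier]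
  [completeSpace : CompleteSpace carrier]

attribute [instance] Hilb.normedAddCommGroup Hilb.innerProductSpace Hilb.completeSpace

namespace Hilb

/-- Morphisms are continuous linear maps. -/
@[ext]
structure Hom (H K : Hilb.{u}) where
  toCLM : H.carrier →L[ℂ] K.carrier

instance : Category Hilb.{u} where
  Hom H K := Hom H K
  id H := ⟨ContinuousLinearMap.id ℂ H.carrier⟩
  comp f g := ⟨g.toCLM.comp f.toCLM⟩

/-- The dagger is the Hilbert space adjoint. -/
instance : DaggerCategory Hilb.{u} where
  dag f := ⟨ContinuousLinearMap.adjoint f.toCLM⟩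
  dag_id H := Hom.ext (by
    refine ((ContinuousLinearMap.eq_adjoint_iff _ _).mpr fun x y => ?_).symm
    rfl)
  dag_comp f g := Hom.ext (ContinuousLinearMap.adjoint_comp g.toCLM f.toCLM)
  dag_dag f := Hom.ext (ContinuousLinearMap.adjoint_adjoint f.toCLM)

/-- `f ≤ g` when the orthogonal complement of the kernel of `f` is contained in that of `g`, and
`f` and `g` agree on the former. -/
instance (H K : Hilb.{u}) : PartialOrder (H ⟶ K) where
  le f g := (LinearMap.ker f.toCLM.toLinearMap)ᗮ ≤ (LinearMap.ker g.toCLM.toLinearMap)ᗮ ∧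
    ∀ x ∈ (LinearMap.ker f.toCLM.toLinearMap)ᗮ, f.toCLM x = g.toCLM x
  le_refl _ := ⟨le_rfl, fun _ _ => rfl⟩
  le_trans _ _ _ h1 h2 :=
    ⟨h1.1.trans h2.1, fun x hx => (h1.2 x hx).trans (h2.2 x (h1.1 hx))⟩
  le_antisymm f g h1 h2 := by
    have hker : LinearMap.ker f.toCLM.toLinearMap = LinearMap.ker g.toCLM.toLinearMap := by
      have hf : CompleteSpace (LinearMap.ker f.toCLM.toLinearMap) :=
        f.toCLM.isClosed_ker.completeSpace_coe
      have hg : CompleteSpace (LinearMap.ker g.toCLM.toLinearMap) :=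
        g.toCLM.isClosed_ker.completeSpace_coe
      rw [← Submodule.orthogonal_orthogonal (LinearMap.ker f.toCLM.toLinearMap),
        ← Submodule.orthogonal_orthogonal (LinearMap.ker g.toCLM.toLinearMap),
        le_antisymm h1.1 h2.1]
    have hf : CompleteSpace (LinearMap.ker f.toCLM.toLinearMap) :=
      f.toCLM.isClosed_ker.completeSpace_coe
    refine Hom.ext (ContinuousLinearMap.ext fun x => ?_)
    obtain ⟨y, hy, z, hz, rfl⟩ :=
      (LinearMap.ker f.toCLM.toLinearMap).exists_add_mem_mem_orthogonal x
    have hy' : y ∈ LinearMap.ker g.toCLM.toLinearMap := hker ▸ hy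
    have e1 : f.toCLM y = 0 := hy
    have e2 : g.toCLM y = 0 := hy'
    rw [map_add, map_add, e1, e2, h1.2 z hz]

/-- A continuous linear equivalence, as an isomorphism. -/
def isoOfEquiv {H K : Hilb.{u}} (e : H.carrier ≃L[ℂ] K.carrier) : H ≅ K where
  hom := ⟨e⟩
  inv := ⟨e.symm⟩
  hom_inv_id := Hom.ext (ContinuousLinearMap.ext fun x => e.symm_apply_apply x)
  inv_hom_id := Hom.ext (ContinuousLinearMap.ext fun x => e.apply_symm_apply x)

@[simp] theorem id_toCLM (H : Hilb.{u}) (x : H.carrier) : Hom.toCLM (𝟙 H) x = x := rfl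

@[simp] theorem comp_toCLM {H K L : Hilb.{u}} (f : H ⟶ K) (g : K ⟶ L) (x : H.carrier) :
    Hom.toCLM (f ≫ g) x = g.toCLM (f.toCLM x) := rfl

/-- The Hilbert tensor product of two Hilbert spaces. -/
def tensorObj (H K : Hilb.{u}) : Hilb.{u} := of (HilbertTensor H.carrier K.carrier)

/-- The pure tensor `h ⊗ k`. -/
def tmul {H K : Hilb.{u}} (h : H.carrier) (k : K.carrier) : (tensorObj H K).carrier :=
  HilbertTensor.tmul h k

theorem tmul_smul {H K : Hilb.{u}} (h : H.carrier) (z : ℂ) (k : K.carrier) :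
    tmul h (z • k) = tmul (z • h) k :=
  HilbertTensor.tmul_smul h z k

/-- Tensoring with a fixed vector on the left. -/
def tmulLeft {H : Hilb.{u}} (h : H.carrier) (K : Hilb.{u}) : K ⟶ tensorObj H K :=
  ⟨HilbertTensor.tmulL H.carrier K.carrier h⟩

/-- Tensoring with a fixed vector on the right. -/
def tmulRight (H : Hilb.{u}) {K : Hilb.{u}} (k : K.carrier) : H ⟶ tensorObj H K :=
  ⟨(HilbertTensor.tmulL H.carrier K.carrier).flip k⟩

/-- Morphisms out of a Hilbert tensor product agree if they do on pure tensors. -/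
theorem hom_ext_tmul {H K L : Hilb.{u}} {f g : tensorObj H K ⟶ L}
    (e : ∀ h k, f.toCLM (tmul h k) = g.toCLM (tmul h k)) : f = g :=
  Hom.ext (HilbertTensor.ext_tmul e)

theorem hom_ext_tmul_left {H K L M : Hilb.{u}} {f g : tensorObj (tensorObj H K) L ⟶ M}
    (e : ∀ h k l, f.toCLM (tmul (tmul h k) l) = g.toCLM (tmul (tmul h k) l)) : f = g :=
  hom_ext_tmul fun z l => by
    have : tmulRight (tensorObj H K) l ≫ f = tmulRight (tensorObj H K) l ≫ g :=
      hom_ext_tmul fun h k => e h k l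
    exact congrArg (fun t => Hom.toCLM t z) this

theorem hom_ext_tmul_right {H K L M : Hilb.{u}} {f g : tensorObj H (tensorObj K L) ⟶ M}
    (e : ∀ h k l, f.toCLM (tmul h (tmul k l)) = g.toCLM (tmul h (tmul k l))) : f = g :=
  hom_ext_tmul fun h z => by
    have : tmulLeft h (tensorObj K L) ≫ f = tmulLeft h (tensorObj K L) ≫ g :=
      hom_ext_tmul fun k l => e h k l
    exact congrArg (fun t => Hom.toCLM t z) this

theorem hom_ext_tmul_left_left {H K L M N : Hilb.{u}}
    {f g : tensorObj (tensorObj (tensorObj H K) L) M ⟶ N}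
    (e : ∀ h k l m, f.toCLM (tmul (tmul (tmul h k) l) m) =
      g.toCLM (tmul (tmul (tmul h k) l) m)) : f = g :=
  hom_ext_tmul fun z m => by
    have : tmulRight (tensorObj (tensorObj H K) L) m ≫ f =
        tmulRight (tensorObj (tensorObj H K) L) m ≫ g :=
      hom_ext_tmul_left fun h k l => e h k l m
    exact congrArg (fun t => Hom.toCLM t z) this

/-- The tensor product of two continuous linear maps. -/
def tensorHom {H H' K K' : Hilb.{u}} (f : H ⟶ H') (g : K ⟶ K') :
    tensorObj H K ⟶ tensorObj H' K' :=
  ⟨HilbertTensor.map f.toCLM g.toCLM⟩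

@[simp] theorem tensorHom_tmul {H H' K K' : Hilb.{u}} (f : H ⟶ H') (g : K ⟶ K')
    (h : H.carrier) (k : K.carrier) :
    (tensorHom f g).toCLM (tmul h k) = tmul (f.toCLM h) (g.toCLM k) :=
  HilbertTensor.map_tmul f.toCLM g.toCLM h k

/-- The associator `(h ⊗ k) ⊗ l ↦ h ⊗ (k ⊗ l)`. -/
def tensorAssoc (H K L : Hilb.{u}) :
    tensorObj (tensorObj H K) L ≅ tensorObj H (tensorObj K L) :=
  isoOfEquiv (HilbertTensor.assoc H.carrier K.carrier L.carrier)

@[simp] theorem tensorAssoc_hom_tmul {H K L : Hilb.{u}} (h : H.carrier) (k : K.carrier)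
    (l : L.carrier) :
    (tensorAssoc H K L).hom.toCLM (tmul (tmul h k) l) = tmul h (tmul k l) :=
  HilbertTensor.assoc_tmul h k l

@[simp] theorem tensorAssoc_inv_tmul {H K L : Hilb.{u}} (h : H.carrier) (k : K.carrier)
    (l : L.carrier) :
    (tensorAssoc H K L).inv.toCLM (tmul h (tmul k l)) = tmul (tmul h k) l :=
  HilbertTensor.assoc_symm_tmul h k l

/-- The tensor unit: the one-dimensional Hilbert space `ℂ`. -/
def tensorUnit : Hilb.{u} := of (ULift.{u} ℂ)

/-- The left unitor `z ⊗ h ↦ z • h`. -/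
def tensorLeftUnitor (H : Hilb.{u}) : tensorObj tensorUnit H ≅ H :=
  isoOfEquiv (HilbertTensor.lunit H.carrier)

@[simp] theorem tensorLeftUnitor_hom_tmul {H : Hilb.{u}} (z : tensorUnit.{u}.carrier)
    (h : H.carrier) :
    (tensorLeftUnitor H).hom.toCLM (tmul z h) = (z : ULift.{u} ℂ).down • h :=
  HilbertTensor.lunit_tmul z h

/-- The right unitor `h ⊗ z ↦ z • h`. -/
def tensorRightUnitor (H : Hilb.{u}) : tensorObj H tensorUnit ≅ H :=
  isoOfEquiv (HilbertTensor.runit H.carrier)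

@[simp] theorem tensorRightUnitor_hom_tmul {H : Hilb.{u}} (z : tensorUnit.{u}.carrier)
    (h : H.carrier) :
    (tensorRightUnitor H).hom.toCLM (tmul h z) = (z : ULift.{u} ℂ).down • h :=
  HilbertTensor.runit_tmul z h

/-- The symmetry `h ⊗ k ↦ k ⊗ h`. -/
def tensorComm (H K : Hilb.{u}) : tensorObj H K ≅ tensorObj K H :=
  isoOfEquiv (HilbertTensor.comm H.carrier K.carrier)

@[simp] theorem tensorComm_hom_tmul {H K : Hilb.{u}} (h : H.carrier) (k : K.carrier) :
    (tensorComm H K).hom.toCLM (tmul h k) = tmul k h :=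
  HilbertTensor.comm_tmul h k

/-- The monoidal structure on Hilbert spaces given by the Hilbert tensor product, with unit `ℂ`. -/
@[reducible] def tensorMonoidal : MonoidalCategory Hilb.{u} :=
  letI : MonoidalCategoryStruct Hilb.{u} :=
    { tensorObj := tensorObj
      tensorHom := tensorHom
      whiskerLeft := fun H _ _ g => tensorHom (𝟙 H) g
      whiskerRight := fun f K => tensorHom f (𝟙 K)
      tensorUnit := tensorUnit
      associator := tensorAssoc
      leftUnitor := tensorLeftUnitor
      rightUnitor := tensorRightUnitor }
  MonoidalCategory.ofTensorHom
    (id_tensorHom_id := fun X Y => by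
      change tensorHom (𝟙 X) (𝟙 Y) = 𝟙 _
      exact hom_ext_tmul fun a b => by simp)
    (id_tensorHom := fun _ _ _ _ => rfl)
    (tensorHom_id := fun _ _ => rfl)
    (tensorHom_comp_tensorHom := fun f g h k => by
      change tensorHom f g ≫ tensorHom h k = tensorHom (f ≫ h) (g ≫ k)
      exact hom_ext_tmul fun a b => by simp)
    (associator_naturality := fun f g h => by
      change tensorHom (tensorHom f g) h ≫ (tensorAssoc _ _ _).hom =
        (tensorAssoc _ _ _).hom ≫ tensorHom f (tensorHom g h)
      exact hom_ext_tmul_left fun a b c => by simp)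
    (leftUnitor_naturality := fun f => by
      change tensorHom (𝟙 _) f ≫ (tensorLeftUnitor _).hom = (tensorLeftUnitor _).hom ≫ f
      exact hom_ext_tmul fun a b => by simp)
    (rightUnitor_naturality := fun f => by
      change tensorHom f (𝟙 _) ≫ (tensorRightUnitor _).hom = (tensorRightUnitor _).hom ≫ f
      exact hom_ext_tmul fun a b => by simp)
    (pentagon := fun W X Y Z => by
      change tensorHom (tensorAssoc W X Y).hom (𝟙 Z) ≫ (tensorAssoc W (tensorObj X Y) Z).hom ≫
          tensorHom (𝟙 W) (tensorAssoc X Y Z).hom =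
        (tensorAssoc (tensorObj W X) Y Z).hom ≫ (tensorAssoc W X (tensorObj Y Z)).hom
      exact hom_ext_tmul_left_left fun a b c d => by simp)
    (triangle := fun X Y => by
      change (tensorAssoc X tensorUnit Y).hom ≫ tensorHom (𝟙 X) (tensorLeftUnitor Y).hom =
        tensorHom (tensorRightUnitor X).hom (𝟙 Y)
      exact hom_ext_tmul_left fun a b c => by simp [tmul_smul])

/-- The symmetry `h ⊗ k ↦ k ⊗ h` for the Hilbert tensor product. -/
@[reducible] def tensorSymmetric : @SymmetricCategory Hilb.{u} _ tensorMonoidal :=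
  letI := tensorMonoidal.{u}
  { braiding := tensorComm
    braiding_naturality_right := fun X {Y Z} f => by
      change tensorHom (𝟙 X) f ≫ (tensorComm _ _).hom = (tensorComm _ _).hom ≫ tensorHom f (𝟙 X)
      exact hom_ext_tmul fun a b => by simp
    braiding_naturality_left := fun {X Y} f Z => by
      change tensorHom f (𝟙 Z) ≫ (tensorComm _ _).hom = (tensorComm _ _).hom ≫ tensorHom (𝟙 Z) f
      exact hom_ext_tmul fun a b => by simp
    hexagon_forward := fun X Y Z => by
      change (tensorAssoc X Y Z).hom ≫ (tensorComm X (tensorObj Y Z)).hom ≫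
          (tensorAssoc Y Z X).hom =
        tensorHom (tensorComm X Y).hom (𝟙 Z) ≫ (tensorAssoc Y X Z).hom ≫
          tensorHom (𝟙 Y) (tensorComm X Z).hom
      exact hom_ext_tmul_left fun a b c => by simp
    hexagon_reverse := fun X Y Z => by
      change (tensorAssoc X Y Z).inv ≫ (tensorComm (tensorObj X Y) Z).hom ≫
          (tensorAssoc Z X Y).inv =
        tensorHom (𝟙 X) (tensorComm Y Z).hom ≫ (tensorAssoc X Z Y).inv ≫
          tensorHom (tensorComm X Z).hom (𝟙 Y)
      exact hom_ext_tmul_right fun a b c => by simp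
    symmetry := fun X Y => by
      change (tensorComm X Y).hom ≫ (tensorComm Y X).hom = 𝟙 _
      exact hom_ext_tmul fun a b => by simp }

/-- The monoidal structure on Hilbert spaces given by direct sums, with unit the zero space. -/
@[reducible] def sumMonoidal : MonoidalCategory Hilb.{u} :=
  letI : MonoidalCategoryStruct Hilb.{u} :=
    { tensorObj := fun H K => of (HilbertSum H.carrier K.carrier)
      tensorHom := fun f g => ⟨HilbertSum.map f.toCLM g.toCLM⟩
      whiskerLeft := fun H _ _ g => ⟨HilbertSum.map (ContinuousLinearMap.id ℂ H.carrier) g.toCLM⟩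
      whiskerRight := fun f K => ⟨HilbertSum.map f.toCLM (ContinuousLinearMap.id ℂ K.carrier)⟩
      tensorUnit := of PUnit.{u + 1}
      associator := fun H K L => isoOfEquiv (HilbertSum.assoc H.carrier K.carrier L.carrier)
      leftUnitor := fun H => isoOfEquiv (HilbertSum.lunit H.carrier)
      rightUnitor := fun H => isoOfEquiv (HilbertSum.runit H.carrier) }
  MonoidalCategory.ofTensorHom
    (id_tensorHom_id := fun _ _ => rfl)
    (id_tensorHom := fun _ _ _ _ => rfl)
    (tensorHom_id := fun _ _ => rfl)
    (tensorHom_comp_tensorHom := fun _ _ _ _ => rfl)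
    (associator_naturality := fun _ _ _ => rfl)
    (leftUnitor_naturality := fun _ => rfl)
    (rightUnitor_naturality := fun _ => rfl)
    (pentagon := fun _ _ _ _ => rfl)
    (triangle := fun _ _ => rfl)

/-- The symmetry exchanging the two summands of a direct sum. -/
@[reducible] def sumSymmetric : @SymmetricCategory Hilb.{u} _ sumMonoidal :=
  letI := sumMonoidal.{u}
  { braiding := fun H K => isoOfEquiv (HilbertSum.comm H.carrier K.carrier)
    braiding_naturality_right := fun _ _ _ _ => rfl
    braiding_naturality_left := fun _ _ => rfl
    hexagon_forward := fun _ _ _ => rfl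
    hexagon_reverse := fun _ _ _ => rfl
    symmetry := fun _ _ => rfl }

end Hilb

/-! ### The functor -/

/-- The values of `φ ∘ f†`, which is `φ` transported along `f` and extended by `0`. -/
def ell2Fun {A B : Type u} (f : A ≃. B) (φ : A → ℂ) (b : B) : ℂ := (f.symm b).elim 0 φ

theorem ell2Fun_sq {A B : Type u} (f : A ≃. B) {φ : A → ℂ} (hφ : Summable fun a => ‖φ a‖ ^ 2) :
    Summable (fun b => ‖ell2Fun f φ b‖ ^ 2) ∧
      ∑' b, ‖ell2Fun f φ b‖ ^ 2 ≤ ∑' a, ‖φ a‖ ^ 2 := by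
  let S : Set B := {b | (f.symm b).isSome}
  let g : S → A := fun b => (f.symm b.1).get b.2
  have hg : Function.Injective g := by
    intro b c h
    have h1 : g b ∈ f.symm b.1 := Option.get_mem _
    have h2 : g c ∈ f.symm c.1 := Option.get_mem _
    rw [h] at h1
    exact Subtype.ext (f.symm.inj h1 h2)
  have hS : (fun b => ‖ell2Fun f φ b‖ ^ 2) = S.indicator fun b => ‖ell2Fun f φ b‖ ^ 2 := by
    refine (Set.indicator_eq_self.mpr fun b hb => ?_).symm
    by_contra hn
    apply hb
    have : f.symm b = none := by simpa [S] using hn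
    simp [ell2Fun, this]
  have hc : (fun b => ‖ell2Fun f φ b‖ ^ 2) ∘ ((↑) : S → B) = (fun a => ‖φ a‖ ^ 2) ∘ g := by
    funext b
    have h1 : f.symm b.1 = some (g b) := (Option.some_get b.2).symm
    simp [ell2Fun, h1]
  have hs : Summable ((fun b => ‖ell2Fun f φ b‖ ^ 2) ∘ ((↑) : S → B)) := by
    rw [hc]
    exact hφ.comp_injective hg
  refine ⟨?_, ?_⟩
  · rw [hS]
    exact summable_subtype_iff_indicator.mp hs
  · rw [hS, ← tsum_subtype S]
    change ∑' b : S, ((fun b => ‖ell2Fun f φ b‖ ^ 2) ∘ ((↑) : S → B)) b ≤ _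
    rw [hc]
    exact tsum_comp_le_tsum_of_inj hφ (fun _ => by positivity) hg

theorem memℓp_two_iff {A : Type u} {φ : A → ℂ} : Memℓp φ 2 ↔ Summable fun a => ‖φ a‖ ^ 2 := by
  rw [memℓp_gen_iff (by norm_num)]
  simp

/-- The Hilbert space of square-summable families of complex numbers indexed by `A`. -/
abbrev SquareSummable (A : Type u) : Type u := lp (fun _ : A => ℂ) 2

/-- The continuous linear map `φ ↦ φ ∘ f†` induced by a partial injection `f`. -/
def ell2Map {A B : Type u} (f : A ≃. B) : SquareSummable A →L[ℂ] SquareSummable B :=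
  LinearMap.mkContinuous
    { toFun := fun φ => ⟨ell2Fun f φ, memℓp_two_iff.mpr
        (ell2Fun_sq f (memℓp_two_iff.mp (lp.memℓp φ))).1⟩
      map_add' := fun φ ψ => by
        refine lp.ext (funext fun b => ?_)
        change (f.symm b).elim 0 (fun a => φ a + ψ a) =
          (f.symm b).elim 0 (fun a => φ a) + (f.symm b).elim 0 (fun a => ψ a)
        cases f.symm b <;> simp
      map_smul' := fun z φ => by
        refine lp.ext (funext fun b => ?_)
        change (f.symm b).elim 0 (fun a => z * φ a) = z * (f.symm b).elim 0 (fun a => φ a)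
        cases f.symm b <;> simp } 1 fun φ => by
    rw [one_mul]
    refine le_of_sq_le_sq ?_ (norm_nonneg _)
    have key := (ell2Fun_sq f (memℓp_two_iff.mp (lp.memℓp φ))).2
    have h1 := lp.norm_rpow_eq_tsum (p := 2) (by norm_num) φ
    have h2 := fun ψ : SquareSummable B => lp.norm_rpow_eq_tsum (p := 2) (by norm_num) ψ
    simp only [ENNReal.toReal_ofNat, Real.rpow_ofNat] at h1 h2
    rw [h1, h2]
    exact key

theorem ell2Map_apply {A B : Type u} (f : A ≃. B) (φ : SquareSummable A) (b : B) :
    ell2Map f φ b = (f.symm b).elim 0 φ := rfl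

/-- The functor sending a set `X` to the Hilbert space of square-summable functions `X → ℂ`, and a
partial injection `f` to `φ ↦ φ ∘ f†`. -/
def ell2 : PInj.{u} ⥤ Hilb.{u} where
  obj X := Hilb.of (SquareSummable X.carrier)
  map f := ⟨ell2Map f.toPEquiv⟩
  map_id X := Hilb.Hom.ext <| ContinuousLinearMap.ext fun φ => lp.ext <| funext fun _ => rfl
  map_comp {X Y Z} f g := Hilb.Hom.ext <| ContinuousLinearMap.ext fun φ => lp.ext <|
    funext fun z => by
      change ((f.toPEquiv.trans g.toPEquiv).symm z).elim 0 φ =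
        (g.toPEquiv.symm z).elim 0 (fun y => (f.toPEquiv.symm y).elim 0 φ)
      rw [PEquiv.symm_trans_rev, PInj.trans_apply]
      cases g.toPEquiv.symm z <;> rfl

/-- The value of an element of `ell2.obj X` at a point of `X`. -/
def coord {X : PInj.{u}} (φ : (ell2.obj X).carrier) (x : X.carrier) : ℂ :=
  (show SquareSummable X.carrier from φ) x

end

/-!
A partial injection `f` is determined by what it does to point masses: `ell2Map f` sends the point
mass at `a` to the one at `f a` where `f` is defined and to `0` elsewhere
(`ell2Map_single_of_some`, `ell2Map_single_of_none`). Since point masses span a dense subspace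
(`mem_of_single_mem`), this gives faithfulness (`ell2Map_injective`) and the formula for adjoints
(`ell2Map_symm`). Isomorphisms are then reflected for a formal reason: `f ≫ f† ≫ f = f` in `PInj`,
so if `ell2.map f` is invertible, its inverse is `ell2.map f†`, and faithfulness brings this
back to `PInj`.

For suprema, a directed set of partial injections has as supremum the union of the graphs
(`PInj.exists_union`). The orthogonal complement of the kernel of `ell2Map f` consists of the
functions supported on the domain of `f` (`mem_ker_orthogonal`), and such functions for the union
are limits of sums of point masses in the domains of the members; two continuous maps that agree
on these point masses agree on the limits (`isLUB_ell2_map`).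

The tensor structure map is multiplication of functions. It preserves inner products because a
double sum of products factors, and its range is dense because it contains the point masses, so it
extends to a unitary `tensorEquiv` from the completed tensor product. The structure map
`sumEquiv` for direct sums is assembled from the maps that the inclusions of the two summands and
their daggers induce. Each coherence law is checked coordinatewise, on pure tensors in the case of
tensor products.
-/

noncomputable section

/-! ### Point masses and the action on them -/

namespace SquareSummable

variable {A B : Type u}

/-- A closed subspace containing the point masses of `φ` contains `φ`, the limit of their finite
sums. -/
theorem mem_of_single_mem [DecidableEq A] {S : Submodule ℂ (SquareSummable A)}
    (hS : IsClosed (S : Set (SquareSummable A))) {φ : SquareSummable A}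
    (h : ∀ a, lp.single 2 a (φ a) ∈ S) : φ ∈ S :=
  hS.mem_of_tendsto (lp.hasSum_single (by norm_num) φ)
    (Filter.Eventually.of_forall fun s => S.sum_mem fun a _ => h a)

theorem ell2Map_single_of_none [DecidableEq A] {f : A ≃. B} {a : A} (h : f a = none) (z : ℂ) :
    ell2Map f (lp.single 2 a z) = 0 := by
  refine lp.ext (funext fun b => ?_)
  rw [ell2Map_apply]
  cases hb : f.symm b with
  | none => rfl
  | some c =>
    have hc : f c = some b := PEquiv.eq_some_iff f |>.mp hb
    have : c ≠ a := by rintro rfl; simp [h] at hc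
    simp [lp.single_apply_ne, this]

theorem ell2Map_single_of_some [DecidableEq A] [DecidableEq B] {f : A ≃. B} {a : A} {b : B}
    (h : f a = some b) (z : ℂ) :
    ell2Map f (lp.single 2 a z) = lp.single 2 b z := by
  refine lp.ext (funext fun c => ?_)
  rw [ell2Map_apply]
  by_cases hcb : c = b
  · subst hcb
    rw [(PEquiv.eq_some_iff f).mpr h]
    simp
  · rw [lp.single_apply_ne _ _ _ hcb]
    cases hc : f.symm c with
    | none => rfl
    | some d =>
      have hd : f d = some c := (PEquiv.eq_some_iff f).mp hc
      have : d ≠ a := by rintro rfl; rw [h] at hd; exact hcb (Option.some.inj hd).symm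
      simp [lp.single_apply_ne, this]

/-- The fibres of a partial injection have at most one point, so summing over them is composing
with its inverse. -/
theorem hasSum_fibre (f : A ≃. B) (φ : A → ℂ) (b : B) :
    HasSum (fun a : {a // b ∈ f a} => φ a) (ell2Fun f φ b) := by
  unfold ell2Fun
  cases h : f.symm b with
  | none =>
    have : IsEmpty {a // b ∈ f a} := ⟨fun a => by
      have := (PEquiv.eq_some_iff f).mpr a.2
      simp [h] at this⟩
    exact hasSum_empty
  | some a =>
    let _ : Unique {a // b ∈ f a} :=
      { default := ⟨a, (PEquiv.eq_some_iff f).mp h⟩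
        uniq := fun c => Subtype.ext (f.inj c.2 ((PEquiv.eq_some_iff f).mp h)) }
    exact hasSum_unique _

theorem ell2Map_symm (f : A ≃. B) :
    ell2Map f.symm = ContinuousLinearMap.adjoint (ell2Map f) := by
  classical
  refine (ContinuousLinearMap.eq_adjoint_iff _ _).mpr fun ψ φ => ?_
  -- Both sides are continuous and linear in `φ`, so a point mass may be taken for `φ`.
  have key : innerSL ℂ (ell2Map f.symm ψ) = (innerSL ℂ ψ).comp (ell2Map f) := by
    refine lp.ext_continuousLinearMap (by norm_num) fun a => ContinuousLinearMap.ext fun z => ?_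
    change inner ℂ (ell2Map f.symm ψ) (lp.single 2 a z) = inner ℂ ψ (ell2Map f (lp.single 2 a z))
    rw [lp.inner_single_right, ell2Map_apply, PEquiv.symm_symm]
    cases h : f a with
    | none => simp [ell2Map_single_of_none h]
    | some b => rw [ell2Map_single_of_some h, lp.inner_single_right]; rfl
  exact congrArg (fun T => T φ) key

theorem ell2Map_injective : Function.Injective (ell2Map : (A ≃. B) → _) := by
  classical
  intro f g h
  -- The value of `f` at `a` is read off from the image of the point mass at `a`.
  have key : ∀ (f g : A ≃. B), ell2Map f = ell2Map g → ∀ a b, b ∈ f a → b ∈ g a := by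
    intro f g h a b hab
    have e := congrArg (fun T => T (lp.single 2 a (1 : ℂ))) h
    rw [ell2Map_single_of_some hab] at e
    cases hg : g a with
    | none =>
      rw [ell2Map_single_of_none hg] at e
      have := congrArg (fun φ : SquareSummable B => φ b) e
      simp at this
    | some c =>
      rw [ell2Map_single_of_some hg] at e
      by_contra hne
      have hbc : b ≠ c := fun hbc => hne (by simp [hbc])
      have := congrArg (fun φ : SquareSummable B => φ b) e
      simp [lp.single_apply_ne, hbc] at this
  exact PInj.pequiv_ext_mem fun a b => ⟨key f g h a b, key g f h.symm a b⟩

/-! ### Suprema of partial injections -/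

/-- The orthogonal complement of the kernel of `ell2Map f` consists of the functions supported on
the domain of `f`. -/
theorem mem_ker_orthogonal {f : A ≃. B} {φ : SquareSummable A} :
    φ ∈ (LinearMap.ker (ell2Map f).toLinearMap)ᗮ ↔ ∀ a, f a = none → φ a = 0 := by
  classical
  constructor
  · intro h a ha
    have := (Submodule.mem_orthogonal _ _).mp h (lp.single 2 a 1) (ell2Map_single_of_none ha 1)
    rw [lp.inner_single_left] at this
    simpa using this
  · intro h
    refine (Submodule.mem_orthogonal _ _).mpr fun ψ hψ => ?_
    rw [lp.inner_eq_tsum]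
    refine (tsum_congr fun a => ?_).trans tsum_zero
    cases ha : f a with
    | none => simp [h a ha]
    | some b =>
      have e : ell2Map f ψ b = 0 := by
        rw [show ell2Map f ψ = 0 from hψ]; rfl
      rw [ell2Map_apply, (PEquiv.eq_some_iff f).mpr ha] at e
      have e' : ψ a = 0 := e
      simp [e']

theorem ell2Map_eq_of_le {f g : A ≃. B} (h : f ≤ g) {φ : SquareSummable A}
    (hφ : ∀ a, f a = none → φ a = 0) : ell2Map f φ = ell2Map g φ := by
  refine lp.ext (funext fun b => ?_)
  rw [ell2Map_apply, ell2Map_apply]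
  cases hf : f.symm b with
  | some a =>
    rw [(PEquiv.eq_some_iff g).mpr (h a b ((PEquiv.eq_some_iff f).mp hf))]
  | none =>
    cases hg : g.symm b with
    | none => rfl
    | some a =>
      refine (hφ a ?_).symm
      cases ha : f a with
      | none => rfl
      | some c =>
        have h1 : g a = some c := h a c ha
        have h2 : g a = some b := (PEquiv.eq_some_iff g).mp hg
        obtain rfl : c = b := Option.some.inj (h1.symm.trans h2)
        rw [(PEquiv.eq_some_iff f).mpr ha] at hf
        cases hf

end SquareSummable

open Classical in
theorem dite_choose_eq_some_iff {B : Type u} {p : B → Prop} (hp : ∀ b b', p b → p b' → b = b')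
    (b : B) : (if h : ∃ b, p b then some h.choose else none) = some b ↔ p b := by
  split_ifs with h
  · rw [Option.some.injEq]
    exact ⟨fun e => e ▸ h.choose_spec, fun hb => hp _ _ h.choose_spec hb⟩
  · simp only [reduceCtorEq, false_iff]
    exact fun hb => h ⟨b, hb⟩

open Classical in
/-- The partial injection whose graph is a given relation that is single-valued both ways. -/
def PEquiv.ofGraph {A B : Type u} (R : A → B → Prop) (h₁ : ∀ a b b', R a b → R a b' → b = b')
    (h₂ : ∀ b a a', R a b → R a' b → a = a') : A ≃. B where
  toFun a := if h : ∃ b, R a b then some h.choose else none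
  invFun b := if h : ∃ a, R a b then some h.choose else none
  inv a b := (dite_choose_eq_some_iff (h₂ b) a).trans (dite_choose_eq_some_iff (h₁ a) b).symm

theorem PEquiv.mem_ofGraph {A B : Type u} {R : A → B → Prop}
    (h₁ : ∀ a b b', R a b → R a b' → b = b') (h₂ : ∀ b a a', R a b → R a' b → a = a')
    (a : A) (b : B) : b ∈ PEquiv.ofGraph R h₁ h₂ a ↔ R a b :=
  dite_choose_eq_some_iff (h₁ a) b

/-- The union of the graphs of a directed set of partial injections is again the graph of one. -/
theorem PInj.exists_union {X Y : PInj.{u}} {s : Set (X ⟶ Y)} (hs : DirectedOn (· ≤ ·) s) :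
    ∃ g : X ⟶ Y, ∀ a b, b ∈ g.toPEquiv a ↔ ∃ f ∈ s, b ∈ f.toPEquiv a := by
  have h₁ : ∀ a b b', (∃ f ∈ s, b ∈ f.toPEquiv a) → (∃ f ∈ s, b' ∈ f.toPEquiv a) → b = b' := by
    rintro a b b' ⟨f, hf, hb⟩ ⟨f', hf', hb'⟩
    obtain ⟨k, -, h, h'⟩ := hs f hf f' hf'
    exact Option.mem_unique (h a b hb) (h' a b' hb')
  have h₂ : ∀ b a a', (∃ f ∈ s, b ∈ f.toPEquiv a) → (∃ f ∈ s, b ∈ f.toPEquiv a') → a = a' := by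
    rintro b a a' ⟨f, hf, hb⟩ ⟨f', hf', hb'⟩
    obtain ⟨k, -, h, h'⟩ := hs f hf f' hf'
    exact k.toPEquiv.inj (h a b hb) (h' a' b hb')
  exact ⟨⟨PEquiv.ofGraph _ h₁ h₂⟩, PEquiv.mem_ofGraph h₁ h₂⟩

theorem ell2_map_mono {X Y : PInj.{u}} {f g : X ⟶ Y} (h : f ≤ g) :
    ell2.map f ≤ ell2.map g := by
  refine ⟨fun φ hφ => ?_, fun φ hφ => ?_⟩
  · refine SquareSummable.mem_ker_orthogonal.mpr fun a ha => ?_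
    refine SquareSummable.mem_ker_orthogonal.mp hφ a ?_
    cases hf : f.toPEquiv a with
    | none => rfl
    | some b =>
      have h1 : g.toPEquiv a = some b := h a b hf
      have h2 : g.toPEquiv a = none := ha
      rw [h2] at h1
      cases h1
  · exact SquareSummable.ell2Map_eq_of_le h (SquareSummable.mem_ker_orthogonal.mp hφ)

/-- `ell2` sends unions to suprema. No directedness is needed once the union `g` is a partial
injection: an upper bound of the images agrees with `ell2.map g` on every point mass in the domain
of a member, and those point masses span a dense subspace of `(ker (ell2.map g))ᗮ`. -/
theorem isLUB_ell2_map {X Y : PInj.{u}} {s : Set (X ⟶ Y)} {g : X ⟶ Y}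
    (hg : ∀ a b, b ∈ g.toPEquiv a ↔ ∃ f ∈ s, b ∈ f.toPEquiv a) :
    IsLUB ((fun f => ell2.map f) '' s) (ell2.map g) := by
  classical
  have hub : ∀ f ∈ s, f ≤ g := fun f hf a b hb => (hg a b).mpr ⟨f, hf, hb⟩
  refine ⟨?_, fun k hk => ?_⟩
  · rintro _ ⟨f, hf, rfl⟩
    exact ell2_map_mono (hub f hf)
  let h : SquareSummable X.carrier →L[ℂ] (ell2.obj Y).carrier := k.toCLM
  let T : SquareSummable X.carrier →L[ℂ] (ell2.obj Y).carrier := (ell2.map g).toCLM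
  have key : ∀ φ ∈ (LinearMap.ker T.toLinearMap)ᗮ,
      φ ∈ (LinearMap.ker h.toLinearMap)ᗮ ⊓ LinearMap.ker (T - h).toLinearMap := by
    intro φ hφ
    refine SquareSummable.mem_of_single_mem
      ((Submodule.isClosed_orthogonal _).inter (T - h).isClosed_ker) fun a => ?_
    cases ha : g.toPEquiv a with
    | none =>
      rw [SquareSummable.mem_ker_orthogonal.mp hφ a ha, lp.single_zero]
      exact Submodule.zero_mem _
    | some b =>
      obtain ⟨f, hf, hb⟩ := (hg a b).mp ha
      have hmem : lp.single 2 a (φ a) ∈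
          (LinearMap.ker (ell2Map f.toPEquiv).toLinearMap)ᗮ := by
        refine SquareSummable.mem_ker_orthogonal.mpr fun c hc => ?_
        refine lp.single_apply_ne _ _ _ ?_
        rintro rfl
        have hb' : f.toPEquiv c = some b := hb
        rw [hc] at hb'
        cases hb'
      have hle := hk ⟨f, hf, rfl⟩
      refine ⟨hle.1 hmem, ?_⟩
      have e1 := hle.2 _ hmem
      have e2 := (ell2_map_mono (hub f hf)).2 _ hmem
      exact sub_eq_zero.mpr (e2.symm.trans e1)
  exact ⟨fun φ hφ => (key φ hφ).1, fun φ hφ => sub_eq_zero.mp (key φ hφ).2⟩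

theorem PInj.isLUB_of_union {X Y : PInj.{u}} {s : Set (X ⟶ Y)} {g : X ⟶ Y}
    (hg : ∀ a b, b ∈ g.toPEquiv a ↔ ∃ f ∈ s, b ∈ f.toPEquiv a) : IsLUB s g := by
  refine ⟨fun f hf a b hb => (hg a b).mpr ⟨f, hf, hb⟩, fun k hk a b hb => ?_⟩
  obtain ⟨f, hf, hb⟩ := (hg a b).mp hb
  exact hk hf a b hb

/-! ### Daggers, faithfulness, and isomorphisms -/

theorem ell2_map_dag {X Y : PInj.{u}} (f : X ⟶ Y) :
    ell2.map (DaggerCategory.dag f) = DaggerCategory.dag (ell2.map f) :=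
  Hilb.Hom.ext (SquareSummable.ell2Map_symm f.toPEquiv)

instance ell2_faithful : ell2.{u}.Faithful where
  map_injective h := PInj.Hom.ext
    (SquareSummable.ell2Map_injective (congrArg Hilb.Hom.toCLM h))

/-- Every partial injection is a partial isometry. -/
theorem PInj.comp_dag_comp {X Y : PInj.{u}} (f : X ⟶ Y) :
    f ≫ DaggerCategory.dag f ≫ f = f := by
  refine PInj.Hom.ext (PInj.pequiv_ext_mem fun a b => ?_)
  change b ∈ f.toPEquiv.trans (f.toPEquiv.symm.trans f.toPEquiv) a ↔ _
  simp only [PEquiv.mem_trans, PEquiv.mem_iff_mem]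
  constructor
  · rintro ⟨c, hc, d, hd, hb⟩
    rwa [f.toPEquiv.inj hc hd]
  · exact fun h => ⟨b, h, a, h, h⟩

/-- If `ell2.map f` is invertible, then cancelling it in the image of `f ≫ f† ≫ f = f` shows that
`f†` becomes its inverse, and by faithfulness `f†` is already inverse to `f`. -/
instance ell2_reflectsIsomorphisms : ell2.{u}.ReflectsIsomorphisms where
  reflects {X Y} f hf := by
    have h : ell2.map f ≫ ell2.map (DaggerCategory.dag f) ≫ ell2.map f = ell2.map f := by
      rw [← Functor.map_comp, ← Functor.map_comp, PInj.comp_dag_comp]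
    refine ⟨DaggerCategory.dag f, ell2.map_injective ?_, ell2.map_injective ?_⟩
    · rw [← cancel_mono (ell2.map f), Functor.map_comp, Category.assoc, h, CategoryTheory.Functor.map_id,
        Category.id_comp]
    · rw [← cancel_epi (ell2.map f), Functor.map_comp, h, CategoryTheory.Functor.map_id, Category.comp_id]

/-! ### Coordinates -/

theorem coord_ext {X : PInj.{u}} {φ ψ : (ell2.obj X).carrier}
    (h : ∀ x, coord φ x = coord ψ x) : φ = ψ :=
  lp.ext (funext h)

theorem coord_map {X Y : PInj.{u}} (f : X ⟶ Y) (φ : (ell2.obj X).carrier) (y : Y.carrier) :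
    coord ((ell2.map f).toCLM φ) y = (f.toPEquiv.symm y).elim 0 (coord φ) := rfl

theorem coord_map_isoOfEquiv {X Y : PInj.{u}} (e : X.carrier ≃ Y.carrier)
    (φ : (ell2.obj X).carrier) (y : Y.carrier) :
    coord ((ell2.map (PInj.isoOfEquiv e).hom).toCLM φ) y = coord φ (e.symm y) := rfl

/-! ### Tensor products -/

namespace SquareSummable

variable {A B : Type u}

theorem memℓp_mul (φ : SquareSummable A) (ψ : SquareSummable B) :
    Memℓp (fun p : A × B => φ p.1 * ψ p.2) 2 := by
  refine memℓp_two_iff.mpr ?_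
  have := (memℓp_two_iff.mp (lp.memℓp φ)).mul_of_nonneg (memℓp_two_iff.mp (lp.memℓp ψ))
    (fun _ => by positivity) (fun _ => by positivity)
  simpa only [norm_mul, mul_pow] using this

/-- The function `(a, b) ↦ φ a * ψ b`. -/
def mul (φ : SquareSummable A) (ψ : SquareSummable B) : SquareSummable (A × B) :=
  ⟨fun p => φ p.1 * ψ p.2, memℓp_mul φ ψ⟩

theorem mul_apply (φ : SquareSummable A) (ψ : SquareSummable B) (p : A × B) :
    mul φ ψ p = φ p.1 * ψ p.2 := rfl

theorem inner_mul_mul (φ φ' : SquareSummable A) (ψ ψ' : SquareSummable B) :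
    inner ℂ (mul φ ψ) (mul φ' ψ') = inner ℂ φ φ' * inner ℂ ψ ψ' := by
  have h : HasSum
      (fun p : A × B => inner ℂ (φ p.1) (φ' p.1) * inner ℂ (ψ p.2) (ψ' p.2))
      (inner ℂ (mul φ ψ) (mul φ' ψ')) := by
    have e : (fun p : A × B => inner ℂ (φ p.1) (φ' p.1) * inner ℂ (ψ p.2) (ψ' p.2)) =
        fun p => inner ℂ (mul φ ψ p) (mul φ' ψ' p) := funext fun p => by
      rw [mul_apply, mul_apply]
      simp only [RCLike.inner_apply, map_mul]
      ring
    rw [e]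
    exact lp.hasSum_inner (mul φ ψ) (mul φ' ψ')
  exact ((lp.hasSum_inner (𝕜 := ℂ) φ φ').mul_eq (lp.hasSum_inner (𝕜 := ℂ) ψ ψ') h).symm

/-- The linear map sending `φ ⊗ ψ` to `(a, b) ↦ φ a * ψ b`. -/
def ofTensorₗ (A B : Type u) :
    SquareSummable A ⊗[ℂ] SquareSummable B →ₗ[ℂ] SquareSummable (A × B) :=
  TensorProduct.lift <| LinearMap.mk₂ ℂ mul
    (fun φ φ' ψ => lp.ext <| funext fun p => by simp [mul_apply, add_mul])
    (fun z φ ψ => lp.ext <| funext fun p => by simp [mul_apply, mul_assoc])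
    (fun φ ψ ψ' => lp.ext <| funext fun p => by simp [mul_apply, mul_add])
    (fun z φ ψ => lp.ext <| funext fun p => by simp [mul_apply, mul_left_comm])

theorem inner_ofTensorₗ (s t : SquareSummable A ⊗[ℂ] SquareSummable B) :
    inner ℂ (ofTensorₗ A B s) (ofTensorₗ A B t) = inner ℂ s t := by
  induction s with
  | zero => simp
  | add s s' hs hs' => rw [map_add, inner_add_left, inner_add_left, hs, hs']
  | tmul φ ψ =>
    induction t with
    | zero => simp
    | add t t' ht ht' => rw [map_add, inner_add_right, inner_add_right, ht, ht']
    | tmul φ' ψ' => exact inner_mul_mul φ φ' ψ ψ'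

/-- The isometry sending `φ ⊗ ψ` to `(a, b) ↦ φ a * ψ b`. -/
def ofTensorₗᵢ (A B : Type u) :
    SquareSummable A ⊗[ℂ] SquareSummable B →ₗᵢ[ℂ] SquareSummable (A × B) :=
  (ofTensorₗ A B).isometryOfInner inner_ofTensorₗ

/-- The range contains every point mass, as `δ (a, b)` is the image of `δ a ⊗ δ b`. -/
theorem denseRange_ofTensorₗᵢ : DenseRange (ofTensorₗᵢ A B) := by
  classical
  intro χ
  refine mem_of_single_mem
    (S := (LinearMap.range (ofTensorₗᵢ A B).toLinearMap).topologicalClosure)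
    (Submodule.isClosed_topologicalClosure _) fun p => ?_
  refine Submodule.le_topologicalClosure _
    ⟨lp.single 2 p.1 (χ p : ℂ) ⊗ₜ lp.single 2 p.2 (1 : ℂ), lp.ext (funext fun q => ?_)⟩
  change lp.single (E := fun _ : A => ℂ) 2 p.1 (χ p) q.1 * lp.single (E := fun _ : B => ℂ) 2 p.2 1 q.2 =
    lp.single (E := fun _ : A × B => ℂ) 2 p (χ p) q
  simp only [lp.single_apply, Pi.single_apply, Prod.ext_iff]
  split_ifs <;> simp_all

/-- The unitary `φ ⊗ ψ ↦ ((a, b) ↦ φ a * ψ b)`. -/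
def tensorEquiv (A B : Type u) :
    HilbertTensor (SquareSummable A) (SquareSummable B) ≃L[ℂ] SquareSummable (A × B) :=
  HilbertTensor.extendIso (LinearIsometryEquiv.refl ℂ _) (HilbertTensor.incl _ _) (ofTensorₗᵢ A B)
    HilbertTensor.denseRange_incl denseRange_ofTensorₗᵢ

theorem tensorEquiv_tmul (φ : SquareSummable A) (ψ : SquareSummable B) :
    tensorEquiv A B (HilbertTensor.tmul φ ψ) = mul φ ψ :=
  HilbertTensor.extendIso_apply (LinearIsometryEquiv.refl ℂ _) (HilbertTensor.incl _ _)
    (ofTensorₗᵢ A B) HilbertTensor.denseRange_incl denseRange_ofTensorₗᵢ (φ ⊗ₜ ψ)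

/-- The scalar `z` corresponds to the function on a point with value `z`. -/
def unitEquiv : ULift.{u} ℂ ≃L[ℂ] SquareSummable PUnit.{u + 1} :=
  LinearEquiv.toContinuousLinearEquiv
    { toFun := fun z => ⟨fun _ => z.down, Memℓp.all _⟩
      invFun := fun φ => ⟨φ PUnit.unit⟩
      map_add' := fun _ _ => rfl
      map_smul' := fun _ _ => rfl
      left_inv := fun _ => rfl
      right_inv := fun _ => rfl }

end SquareSummable

/-- The structure isomorphism `ell2 X ⊗ ell2 Y ≅ ell2 (X × Y)`. -/
def ell2TensorIso (X Y : PInj.{u}) :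
    Hilb.tensorObj (ell2.obj X) (ell2.obj Y) ≅ ell2.obj ⟨X.carrier × Y.carrier⟩ :=
  Hilb.isoOfEquiv (SquareSummable.tensorEquiv X.carrier Y.carrier)

theorem coord_ell2TensorIso {X Y : PInj.{u}} (φ : (ell2.obj X).carrier) (ψ : (ell2.obj Y).carrier)
    (p : X.carrier × Y.carrier) :
    coord (X := ⟨X.carrier × Y.carrier⟩) ((ell2TensorIso X Y).hom.toCLM (Hilb.tmul φ ψ)) p =
      coord φ p.1 * coord ψ p.2 :=
  congrArg (fun χ : SquareSummable (X.carrier × Y.carrier) => χ p)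
    (SquareSummable.tensorEquiv_tmul (A := X.carrier) (B := Y.carrier) φ ψ)

/-- The structure isomorphism `ℂ ≅ ell2 1`. -/
def ell2UnitIso : Hilb.tensorUnit.{u} ≅ ell2.obj ⟨PUnit⟩ :=
  Hilb.isoOfEquiv SquareSummable.unitEquiv

theorem ell2TensorIso_natural {X X' Y Y' : PInj.{u}} (f : X ⟶ X') (g : Y ⟶ Y') :
    Hilb.tensorHom (ell2.map f) (ell2.map g) ≫ (ell2TensorIso X' Y').hom =
      (ell2TensorIso X Y).hom ≫ ell2.map
        (X := ⟨X.carrier × Y.carrier⟩) (Y := ⟨X'.carrier × Y'.carrier⟩)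
        ⟨PInj.prodMap f.toPEquiv g.toPEquiv⟩ := by
  refine Hilb.hom_ext_tmul fun φ ψ => coord_ext fun p => ?_
  rw [Hilb.comp_toCLM, Hilb.comp_toCLM, Hilb.tensorHom_tmul, coord_ell2TensorIso, coord_map,
    coord_map, coord_map]
  -- Unfold the inverse of `prodMap` at `p`, to split on the two preimages.
  change _ = ((f.toPEquiv.symm p.1).bind fun a =>
    (g.toPEquiv.symm p.2).map fun c => (a, c)).elim 0 _
  cases f.toPEquiv.symm p.1 <;> cases g.toPEquiv.symm p.2 <;> simp [coord_ell2TensorIso]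

/-- The monoidal structure for tensor products. Morphisms out of an iterated Hilbert tensor product
are determined by pure tensors, on which each coherence law is an identity between products of
coordinates. -/
@[reducible] def ell2TensorCore : @Functor.CoreMonoidal PInj.{u} _ PInj.tensorMonoidal Hilb.{u} _
    Hilb.tensorMonoidal ell2 :=
  letI := PInj.tensorMonoidal.{u}
  letI := Hilb.tensorMonoidal.{u}
  { εIso := ell2UnitIso
    μIso := ell2TensorIso
    μIso_hom_natural_left := fun {X Y} f X' => by
      have := ell2TensorIso_natural f (𝟙 X')
      rw [ell2.map_id] at this
      exact this
    μIso_hom_natural_right := fun {X Y} X' f => by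
      have := ell2TensorIso_natural (𝟙 X') f
      rw [ell2.map_id] at this
      exact this
    associativity := fun X Y Z => by
      change Hilb.tensorHom (ell2TensorIso X Y).hom (𝟙 _) ≫ (ell2TensorIso (X ⊗ Y) Z).hom ≫
          ell2.map (PInj.isoOfEquiv (Equiv.prodAssoc X.carrier Y.carrier Z.carrier)).hom =
        (Hilb.tensorAssoc _ _ _).hom ≫ Hilb.tensorHom (𝟙 _) (ell2TensorIso Y Z).hom ≫
          (ell2TensorIso X (Y ⊗ Z)).hom
      refine Hilb.hom_ext_tmul_left fun φ ψ χ => coord_ext fun p => ?_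
      simp only [Hilb.comp_toCLM, Hilb.tensorHom_tmul, Hilb.tensorAssoc_hom_tmul, Hilb.id_toCLM]
      rw [coord_map_isoOfEquiv]
      erw [coord_ell2TensorIso, coord_ell2TensorIso, coord_ell2TensorIso, coord_ell2TensorIso]
      exact mul_assoc _ _ _
    left_unitality := fun X => by
      change (Hilb.tensorLeftUnitor _).hom = Hilb.tensorHom ell2UnitIso.hom (𝟙 _) ≫
        (ell2TensorIso (𝟙_ PInj) X).hom ≫
          ell2.map (PInj.isoOfEquiv (Equiv.punitProd X.carrier)).hom
      refine Hilb.hom_ext_tmul fun z φ => coord_ext fun x => ?_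
      simp only [Hilb.comp_toCLM, Hilb.tensorHom_tmul, Hilb.tensorLeftUnitor_hom_tmul,
        Hilb.id_toCLM]
      rw [coord_map_isoOfEquiv]
      erw [coord_ell2TensorIso]
      rfl
    right_unitality := fun X => by
      change (Hilb.tensorRightUnitor _).hom = Hilb.tensorHom (𝟙 _) ell2UnitIso.hom ≫
        (ell2TensorIso X (𝟙_ PInj)).hom ≫
          ell2.map (PInj.isoOfEquiv (Equiv.prodPUnit X.carrier)).hom
      refine Hilb.hom_ext_tmul fun φ z => coord_ext fun x => ?_
      simp only [Hilb.comp_toCLM, Hilb.tensorHom_tmul, Hilb.tensorRightUnitor_hom_tmul,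
        Hilb.id_toCLM]
      rw [coord_map_isoOfEquiv]
      erw [coord_ell2TensorIso]
      exact mul_comm _ _ }

/-- The strong symmetric monoidal structure for tensor products. -/
@[reducible] def ell2TensorBraided : @Functor.Braided PInj.{u} _ PInj.tensorMonoidal
    PInj.tensorSymmetric.toBraidedCategory Hilb.{u} _ Hilb.tensorMonoidal
    Hilb.tensorSymmetric.toBraidedCategory ell2 :=
  letI := PInj.tensorMonoidal.{u}
  letI := PInj.tensorSymmetric.{u}
  letI := Hilb.tensorMonoidal.{u}
  letI := Hilb.tensorSymmetric.{u}
  { toMonoidal := ell2TensorCore.toMonoidal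
    braided := fun X Y => by
      change (ell2TensorIso X Y).hom ≫
          ell2.map (PInj.isoOfEquiv (Equiv.prodComm X.carrier Y.carrier)).hom =
        (Hilb.tensorComm _ _).hom ≫ (ell2TensorIso Y X).hom
      refine Hilb.hom_ext_tmul fun φ ψ => coord_ext fun p => ?_
      simp only [Hilb.comp_toCLM, Hilb.tensorComm_hom_tmul]
      rw [coord_map_isoOfEquiv]
      erw [coord_ell2TensorIso, coord_ell2TensorIso]
      exact mul_comm _ _ }

/-! ### Direct sums -/

/-- The inclusion of the left summand, as a partial injection. -/
def PEquiv.inl (A B : Type u) : A ≃. A ⊕ B where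
  toFun a := some (Sum.inl a)
  invFun := Sum.elim some fun _ => none
  inv := by rintro a (b | b) <;> simp [eq_comm]

/-- The inclusion of the right summand, as a partial injection. -/
def PEquiv.inr (A B : Type u) : B ≃. A ⊕ B where
  toFun b := some (Sum.inr b)
  invFun := Sum.elim (fun _ => none) some
  inv := by rintro a (b | b) <;> simp [eq_comm]

namespace SquareSummable

/-- The isomorphism `(φ, ψ) ↦ [φ, ψ]`, continuous in both directions because it is assembled from
the maps induced by the inclusions of the two summands and by their daggers, the restrictions. -/
def sumEquiv (A B : Type u) :
    HilbertSum (SquareSummable A) (SquareSummable B) ≃L[ℂ] SquareSummable (A ⊕ B) :=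
  (HilbertSum.toPair _ _).trans <| ContinuousLinearEquiv.equivOfInverse
    ((ell2Map (PEquiv.inl A B)).coprod (ell2Map (PEquiv.inr A B)))
    ((ell2Map (PEquiv.inl A B).symm).prod (ell2Map (PEquiv.inr A B).symm))
    (fun x => Prod.ext (lp.ext <| funext fun a => add_zero _)
      (lp.ext <| funext fun b => zero_add _))
    (fun φ => lp.ext <| funext fun c => by
      rcases c with a | b
      · exact add_zero _
      · exact zero_add _)

theorem sumEquiv_inl {A B : Type u} (x : HilbertSum (SquareSummable A) (SquareSummable B)) (a : A) :
    sumEquiv A B x (Sum.inl a) = x.fst a :=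
  add_zero (x.fst a)

theorem sumEquiv_inr {A B : Type u} (x : HilbertSum (SquareSummable A) (SquareSummable B)) (b : B) :
    sumEquiv A B x (Sum.inr b) = x.snd b :=
  zero_add (x.snd b)

/-- The zero space consists of the functions on the empty set. -/
def emptyEquiv : PUnit.{u + 1} ≃L[ℂ] SquareSummable PEmpty.{u + 1} :=
  ContinuousLinearEquiv.equivOfInverse 0 0 (fun _ => rfl)
    (fun _ => lp.ext (funext fun a => a.elim))

end SquareSummable

/-- The structure isomorphism `ell2 X ⊕ ell2 Y ≅ ell2 (X + Y)`. -/
def ell2SumIso (X Y : PInj.{u}) :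
    Hilb.of (HilbertSum (ell2.obj X).carrier (ell2.obj Y).carrier) ≅
      ell2.obj ⟨X.carrier ⊕ Y.carrier⟩ :=
  Hilb.isoOfEquiv (SquareSummable.sumEquiv X.carrier Y.carrier)

/-- The structure isomorphism `0 ≅ ell2 ∅`. -/
def ell2ZeroIso : Hilb.of PUnit.{u + 1} ≅ ell2.obj ⟨PEmpty.{u + 1}⟩ :=
  Hilb.isoOfEquiv SquareSummable.emptyEquiv

theorem coord_ell2SumIso_inl {X Y : PInj.{u}}
    (φ : HilbertSum (ell2.obj X).carrier (ell2.obj Y).carrier) (x : X.carrier) :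
    coord (X := ⟨X.carrier ⊕ Y.carrier⟩) ((ell2SumIso X Y).hom.toCLM φ) (Sum.inl x) =
      coord φ.fst x :=
  SquareSummable.sumEquiv_inl φ x

theorem coord_ell2SumIso_inr {X Y : PInj.{u}}
    (φ : HilbertSum (ell2.obj X).carrier (ell2.obj Y).carrier) (y : Y.carrier) :
    coord (X := ⟨X.carrier ⊕ Y.carrier⟩) ((ell2SumIso X Y).hom.toCLM φ) (Sum.inr y) =
      coord φ.snd y :=
  SquareSummable.sumEquiv_inr φ y

theorem ell2SumIso_natural {X X' Y Y' : PInj.{u}} (f : X ⟶ X') (g : Y ⟶ Y')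
    (φ : HilbertSum (ell2.obj X).carrier (ell2.obj Y).carrier) :
    (ell2SumIso X' Y').hom.toCLM (HilbertSum.map (ell2.map f).toCLM (ell2.map g).toCLM φ) =
      (ell2.map (X := ⟨X.carrier ⊕ Y.carrier⟩) (Y := ⟨X'.carrier ⊕ Y'.carrier⟩)
        ⟨PInj.sumMap f.toPEquiv g.toPEquiv⟩).toCLM ((ell2SumIso X Y).hom.toCLM φ) := by
  refine coord_ext ?_
  rintro (x | y)
  · rw [coord_ell2SumIso_inl, coord_map, HilbertSum.map_fst, coord_map]
    change _ = ((f.toPEquiv.symm x).map Sum.inl).elim 0 _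
    cases f.toPEquiv.symm x
    · rfl
    · exact (coord_ell2SumIso_inl _ _).symm
  · rw [coord_ell2SumIso_inr, coord_map, HilbertSum.map_snd, coord_map]
    change _ = ((g.toPEquiv.symm y).map Sum.inr).elim 0 _
    cases g.toPEquiv.symm y
    · rfl
    · exact (coord_ell2SumIso_inr _ _).symm

theorem ell2SumIso_assoc (X Y Z : PInj.{u})
    (φ : HilbertSum (HilbertSum (ell2.obj X).carrier (ell2.obj Y).carrier) (ell2.obj Z).carrier) :
    (ell2.map (PInj.isoOfEquiv (Y := ⟨X.carrier ⊕ Y.carrier ⊕ Z.carrier⟩)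
        (X := ⟨(X.carrier ⊕ Y.carrier) ⊕ Z.carrier⟩)
        (Equiv.sumAssoc X.carrier Y.carrier Z.carrier)).hom).toCLM
      ((ell2SumIso ⟨X.carrier ⊕ Y.carrier⟩ Z).hom.toCLM
        (HilbertSum.map (ell2SumIso X Y).hom.toCLM (ContinuousLinearMap.id ℂ _) φ)) =
    (ell2SumIso X ⟨Y.carrier ⊕ Z.carrier⟩).hom.toCLM
      (HilbertSum.map (ContinuousLinearMap.id ℂ _) (ell2SumIso Y Z).hom.toCLM
        (HilbertSum.assoc _ _ _ φ)) := by
  refine coord_ext ?_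
  rintro (x | y | z) <;> rw [coord_map_isoOfEquiv]
  · rw [coord_ell2SumIso_inl]
    refine (coord_ell2SumIso_inl _ (Sum.inl x)).trans ?_
    rw [HilbertSum.map_fst, coord_ell2SumIso_inl]
    rfl
  · rw [coord_ell2SumIso_inr]
    refine (coord_ell2SumIso_inl _ (Sum.inr y)).trans ?_
    rw [HilbertSum.map_fst, HilbertSum.map_snd, coord_ell2SumIso_inr, coord_ell2SumIso_inl]
    rfl
  · rw [coord_ell2SumIso_inr]
    refine (coord_ell2SumIso_inr _ z).trans ?_
    rw [HilbertSum.map_snd, HilbertSum.map_snd, coord_ell2SumIso_inr]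
    rfl

theorem ell2SumIso_lunit (X : PInj.{u}) (φ : HilbertSum PUnit.{u + 1} (ell2.obj X).carrier) :
    HilbertSum.lunit (ell2.obj X).carrier φ =
      (ell2.map (PInj.isoOfEquiv (X := ⟨PEmpty.{u + 1} ⊕ X.carrier⟩) (Y := X)
          (Equiv.emptySum PEmpty X.carrier)).hom).toCLM
        ((ell2SumIso ⟨PEmpty⟩ X).hom.toCLM
          (HilbertSum.map ell2ZeroIso.{u}.hom.toCLM
            (ContinuousLinearMap.id ℂ (ell2.obj X).carrier) φ)) := by
  refine coord_ext fun x => ?_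
  rw [coord_map_isoOfEquiv]
  exact (coord_ell2SumIso_inr (X := ⟨PEmpty⟩)
    (HilbertSum.map ell2ZeroIso.{u}.hom.toCLM (ContinuousLinearMap.id ℂ (ell2.obj X).carrier) φ)
    x).symm

theorem ell2SumIso_runit (X : PInj.{u}) (φ : HilbertSum (ell2.obj X).carrier PUnit.{u + 1}) :
    HilbertSum.runit (ell2.obj X).carrier φ =
      (ell2.map (PInj.isoOfEquiv (X := ⟨X.carrier ⊕ PEmpty.{u + 1}⟩) (Y := X)
          (Equiv.sumEmpty X.carrier PEmpty)).hom).toCLM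
        ((ell2SumIso X ⟨PEmpty⟩).hom.toCLM
          (HilbertSum.map (ContinuousLinearMap.id ℂ (ell2.obj X).carrier)
            ell2ZeroIso.{u}.hom.toCLM φ)) := by
  refine coord_ext fun x => ?_
  rw [coord_map_isoOfEquiv]
  exact (coord_ell2SumIso_inl (Y := ⟨PEmpty⟩)
    (HilbertSum.map (ContinuousLinearMap.id ℂ (ell2.obj X).carrier) ell2ZeroIso.{u}.hom.toCLM φ)
    x).symm

theorem ell2SumIso_comm (X Y : PInj.{u})
    (φ : HilbertSum (ell2.obj X).carrier (ell2.obj Y).carrier) :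
    (ell2.map (PInj.isoOfEquiv (X := ⟨X.carrier ⊕ Y.carrier⟩) (Y := ⟨Y.carrier ⊕ X.carrier⟩)
        (Equiv.sumComm X.carrier Y.carrier)).hom).toCLM ((ell2SumIso X Y).hom.toCLM φ) =
      (ell2SumIso Y X).hom.toCLM (HilbertSum.comm _ _ φ) := by
  refine coord_ext ?_
  rintro (y | x) <;> rw [coord_map_isoOfEquiv]
  · rw [coord_ell2SumIso_inl]
    exact coord_ell2SumIso_inr φ y
  · rw [coord_ell2SumIso_inr]
    exact coord_ell2SumIso_inl φ x

/-- The monoidal structure for direct sums, from its structure isomorphisms. -/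
@[reducible] def ell2SumCore : @Functor.CoreMonoidal PInj.{u} _ PInj.sumMonoidal Hilb.{u} _
    Hilb.sumMonoidal ell2 :=
  letI := PInj.sumMonoidal.{u}
  letI := Hilb.sumMonoidal.{u}
  { εIso := ell2ZeroIso
    μIso := ell2SumIso
    μIso_hom_natural_left := fun f X' =>
      Hilb.Hom.ext <| ContinuousLinearMap.ext fun φ => ell2SumIso_natural f (𝟙 X') φ
    μIso_hom_natural_right := fun X' f =>
      Hilb.Hom.ext <| ContinuousLinearMap.ext fun φ => ell2SumIso_natural (𝟙 X') f φ
    associativity := fun X Y Z =>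
      Hilb.Hom.ext <| ContinuousLinearMap.ext fun φ => ell2SumIso_assoc X Y Z φ
    left_unitality := fun X =>
      Hilb.Hom.ext <| ContinuousLinearMap.ext fun φ => ell2SumIso_lunit X φ
    right_unitality := fun X =>
      Hilb.Hom.ext <| ContinuousLinearMap.ext fun φ => ell2SumIso_runit X φ }

/-- The strong symmetric monoidal structure for direct sums. -/
@[reducible] def ell2SumBraided : @Functor.Braided PInj.{u} _ PInj.sumMonoidal
    PInj.sumSymmetric.toBraidedCategory Hilb.{u} _ Hilb.sumMonoidal
    Hilb.sumSymmetric.toBraidedCategory ell2 :=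
  letI := PInj.sumMonoidal.{u}
  letI := PInj.sumSymmetric.{u}
  letI := Hilb.sumMonoidal.{u}
  letI := Hilb.sumSymmetric.{u}
  { toMonoidal := ell2SumCore.toMonoidal
    braided := fun X Y =>
      Hilb.Hom.ext <| ContinuousLinearMap.ext fun φ => ell2SumIso_comm X Y φ }

end

theorem mainTheorem10 :
    -- the fibre sums defining the action on morphisms preserve square-summability
    (∀ (X Y : PInj.{u}) (f : X ⟶ Y) (φ : X.carrier → ℂ), Memℓp φ 2 →
      Memℓp (fun y => ∑' x : {x // y ∈ f.toPEquiv x}, φ x) 2 ∧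
      ∑' y, ‖∑' x : {x // y ∈ f.toPEquiv x}, φ x‖ ^ 2 ≤ ∑' x, ‖φ x‖ ^ 2) ∧
    -- and the functor acts by these sums
    (∀ (X Y : PInj.{u}) (f : X ⟶ Y) (φ : (ell2.obj X).carrier) (y : Y.carrier),
      HasSum (fun x : {x // y ∈ f.toPEquiv x} => coord φ x) (coord ((ell2.map f).toCLM φ) y)) ∧
    -- faithful
    ell2.{u}.Faithful ∧
    -- preserves daggers
    (∀ (X Y : PInj.{u}) (f : X ⟶ Y),
      ell2.map (DaggerCategory.dag f) = DaggerCategory.dag (ell2.map f)) ∧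
    -- strong symmetric monoidal from the Cartesian product to the Hilbert tensor product
    (letI := PInj.tensorMonoidal.{u}
     letI := PInj.tensorSymmetric.{u}
     letI := Hilb.tensorMonoidal.{u}
     letI := Hilb.tensorSymmetric.{u}
     ∃ _ : ell2.{u}.Braided,
      (∀ (z : ℂ) (s : PUnit.{u + 1}), coord ((Functor.LaxMonoidal.ε ell2).toCLM (ULift.up z)) s = z) ∧
      ∀ (X Y : PInj.{u}) (φ : (ell2.obj X).carrier) (ψ : (ell2.obj Y).carrier)
        (x : X.carrier) (y : Y.carrier),
        coord ((Functor.LaxMonoidal.μ ell2 X Y).toCLM (Hilb.tmul φ ψ)) (x, y) =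
          coord φ x * coord ψ y) ∧
    -- strong symmetric monoidal from the disjoint union to the direct sum
    (letI := PInj.sumMonoidal.{u}
     letI := PInj.sumSymmetric.{u}
     letI := Hilb.sumMonoidal.{u}
     letI := Hilb.sumSymmetric.{u}
     ∃ _ : ell2.{u}.Braided,
      ∀ (X Y : PInj.{u}) (φ : (ell2.obj X).carrier) (ψ : (ell2.obj Y).carrier),
        (∀ x : X.carrier, coord ((Functor.LaxMonoidal.μ ell2 X Y).toCLM (WithLp.toLp 2 (φ, ψ)))
          (Sum.inl x) = coord φ x) ∧
        (∀ y : Y.carrier, coord ((Functor.LaxMonoidal.μ ell2 X Y).toCLM (WithLp.toLp 2 (φ, ψ)))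
          (Sum.inr y) = coord ψ y)) ∧
    -- preserves suprema of directed sets of morphisms
    (∀ (X Y : PInj.{u}) (s : Set (X ⟶ Y)), s.Nonempty → DirectedOn (· ≤ ·) s →
      ∃ g : X ⟶ Y, IsLUB s g ∧ IsLUB ((fun f => ell2.map f) '' s) (ell2.map g)) ∧
    -- reflects isomorphisms
    ell2.{u}.ReflectsIsomorphisms := by
  refine ⟨fun X Y f φ hφ => ?_, fun X Y f φ y => SquareSummable.hasSum_fibre f.toPEquiv (coord φ) y,
    ell2_faithful, fun X Y f => ell2_map_dag f, ⟨ell2TensorBraided, fun z s => rfl,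
      fun X Y φ ψ x y => coord_ell2TensorIso φ ψ (x, y)⟩,
    ⟨ell2SumBraided, fun X Y φ ψ =>
      ⟨fun x => coord_ell2SumIso_inl (WithLp.toLp 2 (φ, ψ)) x,
        fun y => coord_ell2SumIso_inr (WithLp.toLp 2 (φ, ψ)) y⟩⟩, fun X Y s _ hs => ?_,
    ell2_reflectsIsomorphisms⟩
  · have e : (fun y => ∑' x : {x // y ∈ f.toPEquiv x}, φ x) = ell2Fun f.toPEquiv φ :=
      funext fun y => (SquareSummable.hasSum_fibre f.toPEquiv φ y).tsum_eq
    have h := ell2Fun_sq f.toPEquiv (memℓp_two_iff.mp hφ)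
    rw [← e] at h
    exact ⟨memℓp_two_iff.mpr h.1, h.2⟩
  · obtain ⟨g, hg⟩ := PInj.exists_union hs
    exact ⟨g, PInj.isLUB_of_union hg, isLUB_ell2_map hg⟩
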